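/- Let $T>0$, $\Omega=[0,T]\times[0,T]$, and let $\psi\in C^1([0,T])$ be increasing with $\psi'(x)\neq 0$ for all $x\in[0,T]$. For $\sigma>0$ put $$\mathbf I^{\sigma;\psi}_{0+}u(x_1,x_2)=\frac1{\Gamma(\sigma)^2}\int_0^{x_1}\!\!\int_0^{x_2}\psi'(s_1)\psi'(s_2)(\psi(x_1)-\psi(s_1))^{\sigma-1}(\psi(x_2)-\psi(s_2))^{\sigma-1}u(s_1,s_2)\,ds_2\,ds_1,$$ and let $\mathbf I^{0;\psi}_{0+}$ be the identity. The $\psi$-Hilfer fractional derivative of order $\alpha$ and type $\beta$ is $$\mathbf D u={}^{\mathbf H}\mathbf D^{\alpha,\beta;\psi}_{0+}u=\mathbf I^{\beta(1-\alpha);\psi}_{0+}\left(\frac1{\psi'(x_1)\psi'(x_2)}\frac{\partial^2}{\partial x_1\partial x_2}\right)\mathbf I^{(1-\beta)(1-\alpha);\psi}_{0+}u .$$ Assume $\frac1p<\alpha<1$, $0\le\beta\le1$ and (H) (i) $1<p<2$, $p<q<p^*_\alpha:=\frac{2p}{2-\alpha p}$ and $0\le\mu\in L^\infty(\Omega)$;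 (ii) $0<\gamma<1$ and $q<r<p^*_\alpha$; (iii) $a\in L^\infty(\Omega)$ and $a(x)>0$ for a.a. $x\in\Omega$. Let $L^{\mathcal H}(\Omega)$ be the space of measurable $u:\Omega\to\mathbb R$ with $\rho(u)=\int_\Omega(|u|^p+\mu(x)|u|^q)\,dx<\infty$, with the Luxemburg norm $\|u\|_{\mathcal H}=\inf\{\tau>0:\rho(u/\tau)\le1\}$. Let $\mathbb H=\mathbb H^{\alpha,\beta;\psi}_{\mathcal H,0}(\Omega)$ be the completion of $C_0^\infty(\Omega)$ (smooth functions with compact support in $(0,T)^2$) with respect to the norm $\|u\|=\|\mathbf D u\|_{\mathcal H}+\|u\|_{\mathcal H}$, realized as the closure of the graph of $\mathbf D$ in $L^{\mathcal H}(\Omega)\times L^{\mathcal H}(\Omega)$, so that every $u\in\mathbb H$ has a derivative $\mathbf D u\in L^{\mathcal H}(\Omega)$. For $\lambda\in\mathbb R$ and $u\in\mathbb H$ put $$\mathbf E_\lambda(u)=\frac1p\int_\Omega|\mathbf D u|^p\,dx+\frac1q\int_\Omega\mu(x)|\mathbf D u|^q\,dx-\frac1{1-\gamma}\int_\Omega a(x)|u|^{1-\gamma}\,dx-\frac\lambda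 r\int_\Omega|u|^r\,dx,$$ $$\mathbf N_\lambda=\left\{u\in\mathbb H\setminus\{0\}:\int_\Omega|\mathbf D u|^p\,dx+\int_\Omega\mu(x)|\mathbf D u|^q\,dx=\int_\Omega a(x)|u|^{1-\gamma}\,dx+\lambda\int_\Omega|u|^r\,dx\right\}.$$ Then $\mathbf E_\lambda|_{\mathbf N_\lambda}$ is coercive: for every $M\in\mathbb R$ there is $R\in\mathbb R$ such that $\mathbf E_\lambda(u)\ge M$ for all $u\in\mathbf N_\lambda$ with $\|u\|\ge R$. -/

import Mathlib

open MeasureTheory Set Filter Topology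
open scoped ENNReal

noncomputable section

namespace DoublePhase

/-- The square `Ω = [0,T] × [0,T]`. -/
def square (T : ℝ) : Set (ℝ × ℝ) := Icc 0 T ×ˢ Icc 0 T

/-- Lebesgue measure on `Ω`. -/
def squareMeasure (T : ℝ) : Measure (ℝ × ℝ) := volume.restrict (square T)

/-! ### The fractional operators -/

/-- The left-sided `ψ`-Riemann–Liouville fractional partial integral of two variables, based at
`(0,0)`, of order `σ ≥ 0` in each variable. The integral of order zero is the identity. -/
def fracIntegral (ψ : ℝ → ℝ) (σ : ℝ) (u : ℝ × ℝ → ℝ) : ℝ × ℝ → ℝ := fun x =>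
  if σ = 0 then u x
  else 1 / (Real.Gamma σ * Real.Gamma σ) *
    ∫ s₁ in (0 : ℝ)..x.1, ∫ s₂ in (0 : ℝ)..x.2,
      deriv ψ s₁ * deriv ψ s₂ * (ψ x.1 - ψ s₁) ^ (σ - 1) * (ψ x.2 - ψ s₂) ^ (σ - 1) * u (s₁, s₂)

/-- The weighted mixed partial derivative `(ψ'(x₁) ψ'(x₂))⁻¹ ∂²v / ∂x₁∂x₂`. -/
def weightedMixedDeriv (ψ : ℝ → ℝ) (v : ℝ × ℝ → ℝ) : ℝ × ℝ → ℝ := fun x =>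
  1 / (deriv ψ x.1 * deriv ψ x.2) * deriv (fun s₁ => deriv (fun s₂ => v (s₁, s₂)) x.2) x.1

/-- The left-sided `ψ`-Hilfer fractional partial derivative of order `α` and type `β` (in both
variables), for functions that are regular enough to be differentiated classically. -/
def hilferDeriv (ψ : ℝ → ℝ) (α β : ℝ) (u : ℝ × ℝ → ℝ) : ℝ × ℝ → ℝ :=
  fracIntegral ψ (β * (1 - α))
    (weightedMixedDeriv ψ (fracIntegral ψ ((1 - β) * (1 - α)) u))

/-! ### The Musielak–Orlicz space `L^𝓗(Ω)`, `𝓗(x,t) = t^p + μ(x) t^q` -/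

/-- The modular `ρ(u) = ∫_Ω (|u|^p + μ(x) |u|^q) dx`, with values in `[0,∞]`. -/
def modular (T p q : ℝ) (μ : ℝ × ℝ → ℝ) (u : ℝ × ℝ → ℝ) : ℝ≥0∞ :=
  ∫⁻ x, ENNReal.ofReal (|u x| ^ p + μ x * |u x| ^ q) ∂(squareMeasure T)

/-- Membership in `L^𝓗(Ω)`. -/
def MemLH (T p q : ℝ) (μ : ℝ × ℝ → ℝ) (u : ℝ × ℝ → ℝ) : Prop :=
  AEMeasurable u (squareMeasure T) ∧ modular T p q μ u < ∞

/-- The Luxemburg norm on `L^𝓗(Ω)`. -/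
def luxNorm (T p q : ℝ) (μ : ℝ × ℝ → ℝ) (u : ℝ × ℝ → ℝ) : ℝ :=
  sInf {τ : ℝ | 0 < τ ∧ modular T p q μ (fun x => u x / τ) ≤ 1}

/-! ### The fractional Sobolev space -/

/-- `C_0^∞(Ω)`: smooth functions with compact support in the open square. -/
def IsTest (T : ℝ) (φ : ℝ × ℝ → ℝ) : Prop :=
  ContDiff ℝ (⊤ : ℕ∞) φ ∧ HasCompactSupport φ ∧ tsupport φ ⊆ Ioo 0 T ×ˢ Ioo 0 T

/-- The space `ℍ_{𝓗,0}^{α,β;ψ}(Ω)`: the completion of `C_0^∞(Ω)` for the norm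
`‖φ‖ = ‖D φ‖_𝓗 + ‖φ‖_𝓗`, `D` the `ψ`-Hilfer derivative. Since `L^𝓗(Ω)` is complete, this is the
closure of the graph of `D` on `C_0^∞(Ω)` in `L^𝓗(Ω) × L^𝓗(Ω)`. An element consists of a function
`toFun` and its `ψ`-Hilfer derivative `hderiv`, both considered up to null sets. -/
structure HilferSpace (T α β p q : ℝ) (ψ : ℝ → ℝ) (μ : ℝ × ℝ → ℝ) where
  /-- the function `u` -/
  toFun : ℝ × ℝ → ℝ
  /-- its `ψ`-Hilfer derivative `D u` -/
  hderiv : ℝ × ℝ → ℝ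
  memLH_toFun : MemLH T p q μ toFun
  memLH_hderiv : MemLH T p q μ hderiv
  exists_approx : ∃ φ : ℕ → ℝ × ℝ → ℝ, (∀ n, IsTest T (φ n)) ∧
    (∀ n, MemLH T p q μ (hilferDeriv ψ α β (φ n))) ∧
    Tendsto (fun n => luxNorm T p q μ (fun x => φ n x - toFun x)) atTop (𝓝 0) ∧
    Tendsto (fun n => luxNorm T p q μ (fun x => hilferDeriv ψ α β (φ n) x - hderiv x))
      atTop (𝓝 0)

variable {T α β p q : ℝ} {ψ : ℝ → ℝ} {μ : ℝ × ℝ → ℝ}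

/-- The norm `‖u‖ = ‖D u‖_𝓗 + ‖u‖_𝓗`. -/
def HilferSpace.sobolevNorm (u : HilferSpace T α β p q ψ μ) : ℝ :=
  luxNorm T p q μ u.hderiv + luxNorm T p q μ u.toFun

/-- The energy functional
`E(u) = (1/p) ‖D u‖_{L^p}^p + (1/q) ‖D u‖_{L^q_μ}^q - (1/(1-γ)) ∫ a |u|^{1-γ} - (l/r) ‖u‖_{L^r}^r`,
with parameter `l`. -/
def energy (a : ℝ × ℝ → ℝ) (γ l r : ℝ) (u : HilferSpace T α β p q ψ μ) : ℝ :=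
  1 / p * ∫ x, |u.hderiv x| ^ p ∂(squareMeasure T)
    + 1 / q * ∫ x, μ x * |u.hderiv x| ^ q ∂(squareMeasure T)
    - 1 / (1 - γ) * ∫ x, a x * |u.toFun x| ^ (1 - γ) ∂(squareMeasure T)
    - l / r * ∫ x, |u.toFun x| ^ r ∂(squareMeasure T)

/-- The Nehari manifold of the energy functional. -/
def nehari (a : ℝ × ℝ → ℝ) (γ l r : ℝ) : Set (HilferSpace T α β p q ψ μ) :=
  {u | ¬ (u.toFun =ᵐ[squareMeasure T] 0) ∧
    (∫ x, |u.hderiv x| ^ p ∂(squareMeasure T))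
        + ∫ x, μ x * |u.hderiv x| ^ q ∂(squareMeasure T)
      = (∫ x, a x * |u.toFun x| ^ (1 - γ) ∂(squareMeasure T))
        + l * ∫ x, |u.toFun x| ^ r ∂(squareMeasure T)}

/-- `E` restricted to `S` is coercive: `E(u) → +∞` as `‖u‖ → ∞`, `u ∈ S`. -/
def CoerciveOn (E : HilferSpace T α β p q ψ μ → ℝ) (S : Set (HilferSpace T α β p q ψ μ)) : Prop :=
  ∀ M : ℝ, ∃ R : ℝ, ∀ u ∈ S, R ≤ u.sobolevNorm → M ≤ E u

end DoublePhase

end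

open DoublePhase

/-! On the Nehari set the constraint eliminates the `l`-term whatever the sign of `l`. With `R = ρ(D
u)` and `S = ∫ a |u|^(1-γ)`, the energy is then at least `(1/q - 1/r) R - S / (1-γ)`, where the
first coefficient is positive because `q < r`. Coercivity follows once `S` is of lower order than
`R` and the norm is controlled by `R`.

Both facts come from a Poincaré inequality that bounds `u` in `L^∞` by the `L^p` norm of `D u`.
After the change of coordinate `y = ψ(x) - ψ(0)`, the `ψ`-Riemann–Liouville integrals become
convolutions with measures that form a semigroup (`rlMeasure₂_conv`). For a test function the
derivatives pass through the convolution, so `D φ` is the integral of order `1 - α` of the mixed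
derivative of `φ`, and applying order `α` recovers `φ` (`IsCoord.exists_rlConv_eq`). Since `α >
1/p`, the kernel of order `α` is locally in the dual space `L^{p'}`, and Hölder gives the sup bound
(`IsCoord.exists_enorm_rlConv_le`). The bound passes to the completion along an a.e. convergent
subsequence.

With `X = 1 + R`, this gives `|u| ≤ C X` and `‖u‖ ≤ K X` (`exists_bounds`). So the energy is at
least `c (X - 1) - const · X^(1-γ)`, which tends to infinity with `X`. -/

namespace DoublePhase

/-! ### Riemann–Liouville kernels as a convolution semigroup of measures -/

section RiemannLiouvilleMeasure

open Measure ProbabilityTheory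

/-- The Riemann–Liouville kernel `t ↦ t ^ (σ - 1) / Γ(σ)` on `(0, ∞)`, extended by zero. -/
noncomputable def rlDensity (σ t : ℝ) : ℝ≥0∞ :=
  ENNReal.ofReal (if 0 < t then t ^ (σ - 1) / Real.Gamma σ else 0)

lemma measurable_rlDensity (σ : ℝ) : Measurable (rlDensity σ) := by
  refine ENNReal.measurable_ofReal.comp (Measurable.ite measurableSet_Ioi ?_ measurable_const)
  fun_prop

/-- The measure whose convolution is the Riemann–Liouville integral of order `σ ≥ 0`. -/
noncomputable def rlMeasure (σ : ℝ) : Measure ℝ :=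
  if σ = 0 then dirac 0 else volume.withDensity (rlDensity σ)

instance (σ : ℝ) : SigmaFinite (rlMeasure σ) := by
  unfold rlMeasure
  split_ifs
  · infer_instance
  · exact SigmaFinite.withDensity_ofReal _

lemma rlMeasure_of_pos {σ : ℝ} (hσ : 0 < σ) :
    rlMeasure σ = volume.withDensity (rlDensity σ) := by
  simp [rlMeasure, hσ.ne']

/-- This is Euler's Beta integral. For `x > 0` the substitution `y = x θ` turns the integrand into a
multiple of the Beta density, which has total mass one. -/
lemma lintegral_rlDensity_mul_rlDensity {a b : ℝ} (ha : 0 < a) (hb : 0 < b) (x : ℝ) :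
    ∫⁻ y, rlDensity a y * rlDensity b (-y + x) = rlDensity (a + b) x := by
  rcases le_or_gt x 0 with hx | hx
  · have : ∀ y, rlDensity a y * rlDensity b (-y + x) = 0 := by
      intro y
      rcases le_or_gt y 0 with hy | hy
      · simp [rlDensity, hy.not_gt]
      · have : ¬ (0 < -y + x) := by linarith
        simp [rlDensity, this]
    simp_rw [this]
    simp [rlDensity, hx.not_gt]
  · have himg : (fun θ : ℝ => x * θ) '' univ = univ := by
      rw [image_univ]
      exact (mul_left_surjective₀ hx.ne').range_eq
    have hcv := lintegral_image_eq_lintegral_abs_deriv_mul (s := univ) (f := fun θ => x * θ)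
      (f' := fun _ => x) MeasurableSet.univ
      (fun θ _ => (hasDerivAt_const_mul x).hasDerivWithinAt)
      (fun s _ t _ h => mul_left_cancel₀ hx.ne' h)
      (fun y => rlDensity a y * rlDensity b (-y + x))
    rw [himg] at hcv
    simp only [Measure.restrict_univ] at hcv
    rw [hcv]
    have hGa := Real.Gamma_pos_of_pos ha
    have hGb := Real.Gamma_pos_of_pos hb
    have hGab := Real.Gamma_pos_of_pos (add_pos ha hb)
    have hpt : ∀ θ : ℝ, ENNReal.ofReal |x| *
        (rlDensity a (x * θ) * rlDensity b (-(x * θ) + x))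
          = rlDensity (a + b) x * betaPDF a b θ := by
      intro θ
      rcases le_or_gt θ 0 with hθ | hθ
      · have : ¬ 0 < x * θ := by
          have := mul_nonpos_of_nonneg_of_nonpos hx.le hθ
          linarith
        simp [rlDensity, this, betaPDF_eq_zero_of_nonpos hθ]
      rcases le_or_gt 1 θ with hθ1 | hθ1
      · have : ¬ 0 < -(x * θ) + x := by nlinarith
        simp [rlDensity, this, betaPDF_eq_zero_of_one_le hθ1]
      have h1 : 0 < x * θ := mul_pos hx hθ
      have h2 : 0 < -(x * θ) + x := by nlinarith
      rw [betaPDF_of_pos_lt_one hθ hθ1]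
      simp only [rlDensity, h1, h2, hx, if_true]
      rw [← ENNReal.ofReal_mul (by positivity), ← ENNReal.ofReal_mul (by positivity),
        ← ENNReal.ofReal_mul (by positivity)]
      congr 1
      have h3 : -(x * θ) + x = x * (1 - θ) := by ring
      rw [h3, Real.mul_rpow hx.le hθ.le, Real.mul_rpow hx.le (by linarith), abs_of_pos hx, beta]
      have h4 : x ^ (a + b - 1) = x * (x ^ (a - 1) * x ^ (b - 1)) := by
        nth_rewrite 2 [← Real.rpow_one x]
        rw [← Real.rpow_add hx, ← Real.rpow_add hx]
        congr 1; ring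
      rw [h4]
      field_simp
    simp_rw [hpt]
    rw [lintegral_const_mul _ (show Measurable (betaPDF a b) from (measurable_betaPDFReal a b).ennreal_ofReal),
      lintegral_betaPDF_eq_one ha hb, mul_one]

/-- The semigroup property of the Riemann–Liouville kernels. -/
lemma rlMeasure_conv {a b : ℝ} (ha : 0 ≤ a) (hb : 0 ≤ b) :
    rlMeasure a ∗ rlMeasure b = rlMeasure (a + b) := by
  have h0 : rlMeasure 0 = dirac 0 := if_pos rfl
  rcases ha.eq_or_lt with rfl | ha
  · rw [h0, dirac_zero_conv, zero_add]
  rcases hb.eq_or_lt with rfl | hb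
  · rw [h0, conv_dirac_zero, add_zero]
  rw [rlMeasure_of_pos ha, rlMeasure_of_pos hb, rlMeasure_of_pos (add_pos ha hb),
    conv_withDensity_eq_lconvolution (measurable_rlDensity a) (measurable_rlDensity b)]
  congr 1
  ext x
  exact lintegral_rlDensity_mul_rlDensity ha hb x

lemma rlMeasure_Iio_zero {σ : ℝ} : rlMeasure σ (Iio 0) = 0 := by
  unfold rlMeasure
  split_ifs
  · simp
  · rw [withDensity_apply _ measurableSet_Iio, setLIntegral_congr_fun (g := 0) measurableSet_Iio]
    · simp
    · intro t ht
      have : ¬ (0 : ℝ) < t := not_lt.mpr (le_of_lt ht)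
      simp [rlDensity, this]

/-- Only the singularity at `0` matters, and there `t ^ ((σ - 1) p)` is integrable because its
exponent exceeds `-1`. Power `1` gives local finiteness of the measures; the conjugate exponent
serves in Hölder's inequality. -/
lemma lintegral_rlDensity_rpow_lt_top {σ p : ℝ} (L : ℝ) (hσ : 0 < σ) (hp : 0 < p)
    (h : -1 < (σ - 1) * p) : ∫⁻ t in Iic L, rlDensity σ t ^ p < ∞ := by
  have hG := Real.Gamma_pos_of_pos hσ
  have heq : ∀ t, rlDensity σ t ^ p = (Ioi (0 : ℝ)).indicator
      (fun t => ENNReal.ofReal (t ^ ((σ - 1) * p) / Real.Gamma σ ^ p)) t := by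
    intro t
    by_cases ht : 0 < t
    · rw [indicator_of_mem (mem_Ioi.mpr ht), rlDensity, if_pos ht,
        ENNReal.ofReal_rpow_of_nonneg (by positivity) hp.le,
        Real.div_rpow (by positivity) hG.le, Real.rpow_mul ht.le]
    · rw [indicator_of_notMem (by simpa using ht), rlDensity, if_neg ht]
      simp [hp]
  simp_rw [heq]
  rw [setLIntegral_indicator measurableSet_Ioi, Ioi_inter_Iic]
  rcases le_or_gt L 0 with hL | hL
  · simp [Ioc_eq_empty_of_le hL]
  · have := (intervalIntegral.intervalIntegrable_rpow' (a := 0) (b := L) h).div_const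
      (Real.Gamma σ ^ p)
    rw [intervalIntegrable_iff_integrableOn_Ioc_of_le hL.le] at this
    exact this.lintegral_lt_top

lemma rlMeasure_Iic_lt_top {σ : ℝ} (hσ : 0 ≤ σ) (L : ℝ) : rlMeasure σ (Iic L) < ∞ := by
  rcases hσ.eq_or_lt with rfl | hσ
  · simpa [rlMeasure] using (measure_lt_top (dirac (0 : ℝ)) (Iic L))
  · rw [rlMeasure_of_pos hσ, withDensity_apply _ measurableSet_Iic]
    simpa using lintegral_rlDensity_rpow_lt_top (p := 1) L hσ one_pos (by linarith)

/-- The measure whose convolution is the Riemann–Liouville integral in two variables. -/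
noncomputable def rlMeasure₂ (σ : ℝ) : Measure (ℝ × ℝ) := (rlMeasure σ).prod (rlMeasure σ)

instance (σ : ℝ) : SigmaFinite (rlMeasure₂ σ) := by unfold rlMeasure₂; infer_instance

lemma prod_conv_prod (μ μ' ν ν' : Measure ℝ) [SFinite μ] [SFinite ν] [SFinite μ'] [SFinite ν'] :
    (μ.prod μ') ∗ (ν.prod ν') = (μ ∗ ν).prod (μ' ∗ ν') := by
  refine ext_of_lintegral _ fun f hf => ?_
  rw [lintegral_conv hf, lintegral_prod _ (by fun_prop), lintegral_prod _ (by fun_prop),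
    lintegral_conv (by fun_prop)]
  refine lintegral_congr fun p₁ => ?_
  calc ∫⁻ p₂, ∫⁻ q, f ((p₁, p₂) + q) ∂(ν.prod ν') ∂μ'
      = ∫⁻ p₂, ∫⁻ q₁, ∫⁻ q₂, f (p₁ + q₁, p₂ + q₂) ∂ν' ∂ν ∂μ' := by
        refine lintegral_congr fun p₂ => ?_
        rw [lintegral_prod _ (by fun_prop)]
        rfl
    _ = ∫⁻ q₁, ∫⁻ p₂, ∫⁻ q₂, f (p₁ + q₁, p₂ + q₂) ∂ν' ∂μ' ∂ν := by
        refine lintegral_lintegral_swap (Measurable.aemeasurable ?_)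
        exact Measurable.lintegral_prod_right'
          (f := fun z : (ℝ × ℝ) × ℝ => f (p₁ + z.1.2, z.1.1 + z.2)) (by fun_prop)
    _ = _ := by
        refine lintegral_congr fun q₁ => ?_
        rw [lintegral_conv (by fun_prop)]

lemma rlMeasure₂_conv {a b : ℝ} (ha : 0 ≤ a) (hb : 0 ≤ b) :
    rlMeasure₂ a ∗ rlMeasure₂ b = rlMeasure₂ (a + b) := by
  rw [rlMeasure₂, rlMeasure₂, prod_conv_prod, rlMeasure_conv ha hb, rlMeasure₂]

lemma rlMeasure₂_Iic_lt_top {σ : ℝ} (hσ : 0 ≤ σ) (y : ℝ × ℝ) : rlMeasure₂ σ (Iic y) < ∞ := by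
  rw [show Iic y = Iic y.1 ×ˢ Iic y.2 from (Iic_prod_Iic y.1 y.2).symm, rlMeasure₂,
    Measure.prod_prod]
  exact ENNReal.mul_lt_top (rlMeasure_Iic_lt_top hσ _) (rlMeasure_Iic_lt_top hσ _)

lemma ae_nonneg_rlMeasure₂ (σ : ℝ) : ∀ᵐ t ∂(rlMeasure₂ σ), 0 ≤ t := by
  have h : ∀ᵐ t ∂(rlMeasure σ), 0 ≤ t := by
    rw [ae_iff]
    simpa [Iio] using rlMeasure_Iio_zero (σ := σ)
  filter_upwards [Measure.quasiMeasurePreserving_fst.ae h,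
    Measure.quasiMeasurePreserving_snd.ae h] with t h1 h2
  exact ⟨h1, h2⟩

end RiemannLiouvilleMeasure

/-! ### Convolution with the Riemann–Liouville measures -/

section Convolution

/-- Bounded continuous functions supported in the closed first quadrant. -/
structure IsCausal (h : ℝ × ℝ → ℝ) : Prop where
  continuous : Continuous h
  bounded : ∃ M, ∀ y, |h y| ≤ M
  eq_zero : ∀ y, ¬ 0 ≤ y → h y = 0

/-- The Riemann–Liouville integral `∫ h(y - t) dπ_σ(t)` in two variables. -/
noncomputable def rlConv (σ : ℝ) (h : ℝ × ℝ → ℝ) (y : ℝ × ℝ) : ℝ :=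
  ∫ t, h (y - t) ∂(rlMeasure₂ σ)

variable {σ : ℝ} {h k : ℝ × ℝ → ℝ}

lemma IsCausal.continuous_sub_left (hh : IsCausal h) (y : ℝ × ℝ) : Continuous fun t => h (y - t) :=
  hh.continuous.comp (by fun_prop)

/-- The measure is infinite when `σ > 0`, but causality confines `t` to `Iic y`, which has finite
mass. -/
lemma IsCausal.integrable (hh : IsCausal h) (hσ : 0 ≤ σ) (y : ℝ × ℝ) :
    Integrable (fun t => h (y - t)) (rlMeasure₂ σ) := by
  obtain ⟨M, hM⟩ := hh.bounded
  rw [← integrableOn_iff_integrable_of_support_subset (s := Iic y)]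
  · exact Measure.integrableOn_of_bounded (M := M) (rlMeasure₂_Iic_lt_top hσ y).ne
      (hh.continuous.comp (by fun_prop)).aestronglyMeasurable (ae_of_all _ fun t => hM _)
  · intro t ht
    by_contra hty
    refine ht (hh.eq_zero _ fun hle => hty ?_)
    exact sub_nonneg.mp hle

/-- Differentiation under the integral sign: a directional derivative commutes with the convolution,
and no boundary term appears because `h` is differentiable on the whole plane. -/
lemma IsCausal.hasDerivAt_rlConv (hh : IsCausal h) (hk : IsCausal k) (hσ : 0 ≤ σ) (y e : ℝ × ℝ)
    (hder : ∀ y s, HasDerivAt (fun s : ℝ => h (y + s • e)) (k (y + s • e)) s) (s₀ : ℝ) :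
    HasDerivAt (fun s : ℝ => rlConv σ h (y + s • e)) (rlConv σ k (y + s₀ • e)) s₀ := by
  obtain ⟨M, hM⟩ := hk.bounded
  -- `z` dominates `y + s • e` componentwise for all `s` within distance `1` of `s₀`, so the
  -- constant `M` on `Iic z` is a common integrable bound.
  set z : ℝ × ℝ := y + (|s₀| + 1) • (|e.1|, |e.2|) with hz
  have hM0 : 0 ≤ M := (abs_nonneg _).trans (hM 0)
  have key := hasDerivAt_integral_of_dominated_loc_of_deriv_le (μ := rlMeasure₂ σ) (𝕜 := ℝ)
    (F := fun (s : ℝ) t => h (y + s • e - t)) (F' := fun (s : ℝ) t => k (y + s • e - t))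
    (x₀ := s₀) (s := Metric.ball s₀ 1) (bound := (Iic z).indicator fun _ => M)
    (Metric.ball_mem_nhds _ one_pos)
    (Eventually.of_forall fun s => (hh.continuous.comp (by fun_prop)).aestronglyMeasurable)
    (hh.integrable hσ _) (hk.continuous.comp (by fun_prop)).aestronglyMeasurable
    (ae_of_all _ fun t s hs => ?_) ?_ (ae_of_all _ fun t s _ => ?_)
  · exact key.2
  · by_cases ht : t ∈ Iic z
    · rw [indicator_of_mem ht]; exact hM _
    · rw [indicator_of_notMem ht, hk.eq_zero, norm_zero]
      intro hle
      refine ht ((sub_nonneg.mp hle).trans ?_)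
      have hs' : |s| ≤ |s₀| + 1 := by
        have h1 : |s - s₀| < 1 := by simpa [Real.dist_eq] using hs
        have h2 := abs_sub_abs_le_abs_sub s s₀
        linarith
      have hmul : ∀ c : ℝ, s * c ≤ (|s₀| + 1) * |c| := fun c =>
        (le_abs_self _).trans (by rw [abs_mul]; gcongr)
      exact ⟨by simpa [hz] using hmul e.1, by simpa [hz] using hmul e.2⟩
  · rw [integrable_indicator_iff measurableSet_Iic]
    exact integrableOn_const (rlMeasure₂_Iic_lt_top hσ z).ne
  · have := hder (y - t) s
    simpa only [sub_add_eq_add_sub] using this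

lemma IsCausal.measurable_rlConv (hh : IsCausal h) : Measurable (rlConv σ h) := by
  have : StronglyMeasurable fun z : (ℝ × ℝ) × (ℝ × ℝ) => h (z.1 - z.2) :=
    (hh.continuous.comp (by fun_prop)).stronglyMeasurable
  exact this.integral_prod_right'.measurable

lemma IsCausal.rlConv_eq_zero (hh : IsCausal h) {y : ℝ × ℝ} (hy : ¬ 0 ≤ y) :
    rlConv σ h y = 0 := by
  refine integral_eq_zero_of_ae ?_
  filter_upwards [ae_nonneg_rlMeasure₂ σ] with t ht
  exact hh.eq_zero _ fun hle => hy (ht.trans (sub_nonneg.mp hle))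

lemma IsCausal.integrable_add (hh : IsCausal h) {a b : ℝ} (ha : 0 ≤ a) (hb : 0 ≤ b)
    (y : ℝ × ℝ) :
    Integrable (fun z : (ℝ × ℝ) × (ℝ × ℝ) => h (y - (z.1 + z.2)))
      ((rlMeasure₂ a).prod (rlMeasure₂ b)) := by
  have := hh.integrable (add_nonneg ha hb) y
  rw [← rlMeasure₂_conv ha hb, Measure.conv, integrable_map_measure
    (hh.continuous_sub_left y).aestronglyMeasurable (by fun_prop)] at this
  exact this

lemma IsCausal.integrable_rlConv (hh : IsCausal h) {a b : ℝ} (ha : 0 ≤ a) (hb : 0 ≤ b)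
    (y : ℝ × ℝ) : Integrable (fun s => rlConv b h (y - s)) (rlMeasure₂ a) := by
  simpa only [rlConv, sub_sub] using (hh.integrable_add ha hb y).integral_prod_left

lemma IsCausal.rlConv_rlConv (hh : IsCausal h) {a b : ℝ} (ha : 0 ≤ a) (hb : 0 ≤ b)
    (y : ℝ × ℝ) : rlConv a (rlConv b h) y = rlConv (a + b) h y := by
  rw [rlConv, rlConv, ← rlMeasure₂_conv ha hb, Measure.conv, integral_map (by fun_prop)
    (hh.continuous_sub_left y).aestronglyMeasurable,
    integral_prod _ (hh.integrable_add ha hb y)]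
  simp only [rlConv, sub_sub]

lemma rlMeasure_one : rlMeasure 1 = volume.restrict (Ioi 0) := by
  rw [rlMeasure_of_pos one_pos, ← withDensity_indicator_one measurableSet_Ioi]
  congr 1
  ext t
  by_cases ht : 0 < t <;> simp [rlDensity, ht]

/-- Fundamental theorem of calculus for the antiderivative `t ↦ -f (y - t)`, which vanishes for `t >
y`. -/
lemma integral_Ioi_sub_of_hasDerivAt {f f' : ℝ → ℝ} (hf : ∀ s, HasDerivAt f (f' s) s)
    (hf0 : ∀ s < 0, f s = 0) (hf'0 : ∀ s < 0, f' s = 0) (hc : Continuous f') (y : ℝ) :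
    ∫ t in Ioi (0 : ℝ), f' (y - t) = f y := by
  have hint : IntegrableOn (fun t => f' (y - t)) (Ioi 0) := by
    have hsub : Ioi (0 : ℝ) ⊆ Icc 0 (max y 0) ∪ Ioi (max y 0) := by
      intro t ht
      rcases le_or_gt t (max y 0) with h | h
      · exact Or.inl ⟨le_of_lt ht, h⟩
      · exact Or.inr h
    refine IntegrableOn.mono_set (IntegrableOn.union ?_ ?_) hsub
    · exact (hc.comp (by fun_prop)).continuousOn.integrableOn_Icc
    · refine (integrableOn_zero).congr_fun (fun t ht => ?_) measurableSet_Ioi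
      exact (hf'0 _ (by linarith [le_max_left y 0, mem_Ioi.mp ht])).symm
  have := integral_Ioi_of_hasDerivAt_of_tendsto' (f := fun t => -f (y - t)) (a := 0) (m := 0)
    (fun t _ => ?_) hint ?_
  · simpa using this
  · have := ((hf (y - t)).scomp t ((hasDerivAt_id t).const_sub y)).neg
    simpa [Function.comp_def, Pi.neg_def] using this
  · refine tendsto_const_nhds.congr' ?_
    filter_upwards [eventually_gt_atTop y] with t ht
    rw [hf0 _ (by linarith), neg_zero]

/-- The order-one measure is Lebesgue measure on the quadrant, so the integral undoes the mixed
derivative one variable at a time. -/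
lemma rlConv_one_of_hasDerivAt {h₂ w : ℝ × ℝ → ℝ} (hh : IsCausal h) (hh₂ : IsCausal h₂)
    (hw : IsCausal w)
    (hd₂ : ∀ x y, HasDerivAt (fun s => h (x, s)) (h₂ (x, y)) y)
    (hd₁ : ∀ x y, HasDerivAt (fun s => h₂ (s, y)) (w (x, y)) x) (y : ℝ × ℝ) :
    rlConv 1 w y = h y := by
  have hint := hw.integrable zero_le_one y
  rw [rlConv]
  unfold rlMeasure₂ at hint ⊢
  -- The first variable is integrated first because it was differentiated last.
  rw [integral_prod_symm _ hint, rlMeasure_one]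
  have h1 : ∀ z, ∫ t in Ioi (0 : ℝ), w (y - (t, z)) = h₂ (y.1, y.2 - z) := fun z =>
    integral_Ioi_sub_of_hasDerivAt (f := fun s => h₂ (s, y.2 - z))
      (f' := fun s => w (s, y.2 - z)) (fun s => hd₁ s _)
      (fun s hs => hh₂.eq_zero _ fun hle => absurd hle.1 (not_le.mpr hs))
      (fun s hs => hw.eq_zero _ fun hle => absurd hle.1 (not_le.mpr hs))
      (hw.continuous.comp (by fun_prop)) y.1
  simp_rw [h1]
  exact integral_Ioi_sub_of_hasDerivAt (f := fun s => h (y.1, s)) (f' := fun s => h₂ (y.1, s))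
      (fun s => hd₂ _ s)
      (fun s hs => hh.eq_zero _ fun hle => absurd hle.2 (not_le.mpr hs))
      (fun s hs => hh₂.eq_zero _ fun hle => absurd hle.2 (not_le.mpr hs))
      (hh₂.continuous.comp (by fun_prop)) y.2

end Convolution

/-! ### The change of coordinate by `ψ` and the representation of test functions -/

section Coordinates

/-- A global `C¹` diffeomorphism `e` of the line, with derivative `g`, that agrees with
`ψ - ψ(0)` on `(0, T)`. -/
structure IsCoord (ψ : ℝ → ℝ) (T : ℝ) (e : ℝ ≃ₜ ℝ) (g : ℝ → ℝ) : Prop where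
  zero : e 0 = 0
  mono : StrictMono e
  hasDerivAt : ∀ x, HasDerivAt e (g x) x
  continuous : Continuous g
  pos : ∀ x, 0 < g x
  bdd : ∃ G, ∀ x, g x ≤ G
  deriv_eq : ∀ s ∈ Ioo 0 T, deriv ψ s = g s
  sub_eq : ∀ x ∈ Ioo 0 T, ∀ s ∈ Ioo 0 T, ψ x - ψ s = e x - e s

/-- The derivative of `ψ` on `[0, T]` is continuous and positive, hence bounded away from `0`. It is
extended by its endpoint values and integrated from `0`; the lower bound makes the primitive
strictly increasing and onto. -/
theorem exists_isCoord {ψ : ℝ → ℝ} {T : ℝ} (hT : 0 < T) (hψ : ContDiffOn ℝ 1 ψ (Icc 0 T))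
    (hmono : StrictMonoOn ψ (Icc 0 T)) (hne : ∀ x ∈ Icc 0 T, derivWithin ψ (Icc 0 T) x ≠ 0) :
    ∃ e g, IsCoord ψ T e g := by
  set d := derivWithin ψ (Icc 0 T) with hd
  have hdc : ContinuousOn d (Icc 0 T) :=
    hψ.continuousOn_derivWithin (uniqueDiffOn_Icc hT) le_rfl
  have hdpos : ∀ x ∈ Icc 0 T, 0 < d x := fun x hx =>
    lt_of_le_of_ne hmono.monotoneOn.derivWithin_nonneg (hne x hx).symm
  set g : ℝ → ℝ := fun x => d (projIcc 0 T hT.le x) with hg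
  have hgc : Continuous g :=
    (continuousOn_iff_continuous_domRestrict.mp hdc).comp continuous_projIcc
  have hgd : ∀ x ∈ Icc 0 T, g x = d x := fun x hx => by simp [hg, projIcc_of_mem hT.le hx]
  obtain ⟨m, hm, hmin⟩ := isCompact_Icc.exists_isMinOn (nonempty_Icc.mpr hT.le) hdc
  obtain ⟨m', hm', hmax⟩ := isCompact_Icc.exists_isMaxOn (nonempty_Icc.mpr hT.le) hdc
  have hc := hdpos m hm
  have hgl : ∀ x, d m ≤ g x := fun x => hmin (projIcc 0 T hT.le x).2
  have hgu : ∀ x, g x ≤ d m' := fun x => hmax (projIcc 0 T hT.le x).2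
  set Ψ : ℝ → ℝ := fun x => ∫ s in (0 : ℝ)..x, g s with hΨ
  have hder : ∀ x, HasDerivAt Ψ (g x) x := fun x =>
    intervalIntegral.integral_hasDerivAt_right (hgc.intervalIntegrable _ _)
      (hgc.stronglyMeasurableAtFilter _ _) hgc.continuousAt
  have hstrict : StrictMono Ψ := strictMono_of_hasDerivAt_pos hder fun x => hc.trans_le (hgl x)
  have hcont : Continuous Ψ := continuous_iff_continuousAt.mpr fun x => (hder x).continuousAt
  have hmvt : ∀ x y, x ≤ y → d m * (y - x) ≤ Ψ y - Ψ x := by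
    intro x y hxy
    have : Monotone fun z => Ψ z - d m * z := by
      refine monotone_of_hasDerivAt_nonneg (f' := fun z => g z - d m)
        (fun z => ?_) fun z => sub_nonneg.mpr (hgl z)
      exact (hder z).sub (hasDerivAt_const_mul (d m))
    have := this hxy
    simp only at this
    linarith
  have htop : Tendsto Ψ atTop atTop := by
    refine tendsto_atTop_mono' _ ?_ ((tendsto_id.const_mul_atTop hc).atTop_add
      (tendsto_const_nhds (x := Ψ 0)))
    filter_upwards [eventually_ge_atTop 0] with x hx
    have := hmvt 0 x hx
    simp only [id]; linarith
  have hbot : Tendsto Ψ atBot atBot := by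
    refine tendsto_atBot_mono' _ ?_ ((tendsto_id.const_mul_atBot hc).atBot_add
      (tendsto_const_nhds (x := Ψ 0)))
    filter_upwards [eventually_le_atBot 0] with x hx
    have := hmvt x 0 hx
    simp only [id]; linarith
  have hsurj : Function.Surjective Ψ := hcont.surjective htop hbot
  have hψd : ∀ s ∈ Ioo 0 T, HasDerivAt ψ (g s) s := fun s hs => by
    rw [hgd s (Ioo_subset_Icc_self hs)]
    exact ((hψ.differentiableOn one_ne_zero s
      (Ioo_subset_Icc_self hs)).hasDerivWithinAt).hasDerivAt (Icc_mem_nhds hs.1 hs.2)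
  refine ⟨(hstrict.orderIsoOfSurjective Ψ hsurj).toHomeomorph, g, ?_, hstrict, hder, hgc,
    fun x => hc.trans_le (hgl x), ⟨_, hgu⟩, fun s hs => (hψd s hs).deriv, ?_⟩
  · show Ψ 0 = 0
    simp [hΨ]
  · intro x hx s hs
    show ψ x - ψ s = Ψ x - Ψ s
    -- `ψ` and the primitive have equal derivatives on the open interval, so they differ there by a
    -- constant.
    obtain ⟨c, hc⟩ := (isOpen_Ioo (a := (0:ℝ)) (b := T)).exists_is_const_of_deriv_eq_zero
      isPreconnected_Ioo (f := fun s => ψ s - Ψ s)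
      (fun z hz => ((hψd z hz).sub (hder z)).differentiableAt.differentiableWithinAt)
      (fun z hz => (((hψd z hz).sub (hder z)).deriv).trans (sub_self _))
    have h1 := hc x hx
    have h2 := hc s hs
    linarith

variable {ψ : ℝ → ℝ} {T : ℝ} {e : ℝ ≃ₜ ℝ} {g : ℝ → ℝ}

lemma IsCoord.image_Ioo (he : IsCoord ψ T e g) (x : ℝ) : e '' Ioo 0 x = Ioo 0 (e x) := by
  ext z
  constructor
  · rintro ⟨s, hs, rfl⟩
    exact ⟨by simpa [he.zero] using he.mono hs.1, he.mono hs.2⟩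
  · intro hz
    refine ⟨e.symm z, ⟨?_, ?_⟩, e.apply_symm_apply z⟩
    · rw [← he.mono.lt_iff_lt, he.zero, e.apply_symm_apply]; exact hz.1
    · rw [← he.mono.lt_iff_lt, e.apply_symm_apply]; exact hz.2

lemma IsCoord.hasDerivAt_symm (he : IsCoord ψ T e g) (y : ℝ) :
    HasDerivAt e.symm (g (e.symm y))⁻¹ y :=
  HasDerivAt.of_local_left_inverse e.symm.continuous.continuousAt (he.hasDerivAt _)
    (he.pos _).ne' (Eventually.of_forall e.apply_symm_apply)

/-- In the coordinate `e`, the `ψ`-Riemann–Liouville integral is a convolution. -/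
lemma IsCoord.integral_eq_integral_rlMeasure (he : IsCoord ψ T e g) {σ x : ℝ} (hσ : 0 < σ)
    (hx : x ∈ Ioo 0 T) {f F : ℝ → ℝ} (hf : ∀ s ∈ Ioo 0 T, f s = F (e s))
    (hF : ∀ z < 0, F z = 0) :
    1 / Real.Gamma σ * ∫ s in (0 : ℝ)..x, deriv ψ s * (ψ x - ψ s) ^ (σ - 1) * f s
      = ∫ t, F (e x - t) ∂(rlMeasure σ) := by
  have hGpos := Real.Gamma_pos_of_pos hσ
  rw [rlMeasure_of_pos hσ, integral_withDensity_eq_integral_toReal_smul (measurable_rlDensity σ)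
    (ae_of_all _ fun t => ENNReal.ofReal_lt_top)]
  have hsub := integral_sub_left_eq_self
    (fun z => (rlDensity σ (e x - z)).toReal • F z) volume (e x)
  simp only [sub_sub_cancel] at hsub
  rw [hsub]
  have hset : ∫ z, (rlDensity σ (e x - z)).toReal • F z
      = ∫ z in Ioo 0 (e x), (rlDensity σ (e x - z)).toReal • F z := by
    -- `F` is known to vanish only for `z < 0`, so the point `0` is included here at no cost.
    rw [← integral_Ico_eq_integral_Ioo, setIntegral_eq_integral_of_forall_compl_eq_zero]
    intro z hz
    rcases lt_or_ge z 0 with h0 | h0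
    · rw [hF z h0, smul_zero]
    · have : ¬ 0 < e x - z := fun h => hz ⟨h0, by linarith⟩
      simp [rlDensity, this]
  rw [hset, ← he.image_Ioo, integral_image_eq_integral_abs_deriv_smul measurableSet_Ioo
    (fun s _ => (he.hasDerivAt s).hasDerivWithinAt) he.mono.injective.injOn,
    intervalIntegral.integral_of_le hx.1.le, integral_Ioc_eq_integral_Ioo,
    ← integral_const_mul]
  refine setIntegral_congr_fun measurableSet_Ioo fun s hs => ?_
  have hs' : s ∈ Ioo 0 T := ⟨hs.1, hs.2.trans hx.2⟩
  have hlt : 0 < e x - e s := sub_pos.mpr (he.mono hs.2)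
  simp only [smul_eq_mul]
  rw [he.deriv_eq s hs', he.sub_eq x hx s hs', hf s hs', abs_of_pos (he.pos s), rlDensity,
    if_pos hlt, ENNReal.toReal_ofReal (by positivity)]
  field_simp

/-- Apply the one-variable formula twice, with Fubini. Agreement is required only on the open
square, and integrability is a separate hypothesis, so that the result also applies to the outer
integral in the Hilfer derivative, whose argument is not shown to be `IsCausal`. -/
lemma IsCoord.fracIntegral_eq (he : IsCoord ψ T e g) {σ : ℝ} (hσ : 0 ≤ σ) {u U : ℝ × ℝ → ℝ}
    (hu : ∀ s ∈ Ioo 0 T ×ˢ Ioo 0 T, u s = U (e s.1, e s.2)) (hU : ∀ y, ¬ 0 ≤ y → U y = 0)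
    {x : ℝ × ℝ} (hx : x ∈ Ioo 0 T ×ˢ Ioo 0 T)
    (hint : Integrable (fun t => U ((e x.1, e x.2) - t)) (rlMeasure₂ σ)) :
    fracIntegral ψ σ u x = rlConv σ U (e x.1, e x.2) := by
  rcases hσ.eq_or_lt with rfl | hσ
  · simp only [fracIntegral, if_pos, rlConv, rlMeasure₂, rlMeasure]
    rw [Measure.dirac_prod_dirac, integral_dirac, hu x hx]
    congr 1
    ext <;> simp
  rw [fracIntegral, if_neg hσ.ne', rlConv, rlMeasure₂, integral_prod _ hint]
  have hin : ∀ s₁ ∈ Ioo 0 T, 1 / Real.Gamma σ * ∫ s₂ in (0 : ℝ)..x.2,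
      deriv ψ s₂ * (ψ x.2 - ψ s₂) ^ (σ - 1) * u (s₁, s₂)
        = ∫ t, U (e s₁, e x.2 - t) ∂(rlMeasure σ) := fun s₁ hs₁ =>
    he.integral_eq_integral_rlMeasure hσ hx.2 (f := fun s₂ => u (s₁, s₂))
      (F := fun z => U (e s₁, z)) (fun s hs => hu (s₁, s) ⟨hs₁, hs⟩)
      fun z hz => hU _ fun hle => absurd hle.2 (not_le.mpr hz)
  have hout := he.integral_eq_integral_rlMeasure hσ hx.1
    (f := fun s₁ => 1 / Real.Gamma σ * ∫ s₂ in (0 : ℝ)..x.2,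
      deriv ψ s₂ * (ψ x.2 - ψ s₂) ^ (σ - 1) * u (s₁, s₂))
    (F := fun z => ∫ t, U (z, e x.2 - t) ∂(rlMeasure σ)) hin fun z hz => by
      have : ∀ t, U (z, e x.2 - t) = 0 := fun t =>
        hU _ fun hle => absurd hle.1 (not_le.mpr hz)
      simp [this]
  refine Eq.trans ?_ hout
  -- One factor `1 / Γ(σ)` goes to each of the two one-variable integrals.
  rw [← one_div_mul_one_div, mul_assoc, ← intervalIntegral.integral_const_mul]
  congr 1
  refine intervalIntegral.integral_congr fun s₁ _ => ?_
  rw [mul_left_comm, ← intervalIntegral.integral_const_mul (deriv ψ s₁ * _)]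
  congr 1
  refine intervalIntegral.integral_congr fun s₂ _ => ?_
  ring

/-- The chain rule produces the factor `g x.1 * g x.2`, which the weight cancels. -/
lemma IsCoord.weightedMixedDeriv_eq (he : IsCoord ψ T e g) {v V V₂ W : ℝ × ℝ → ℝ}
    (hv : ∀ s ∈ Ioo 0 T ×ˢ Ioo 0 T, v s = V (e s.1, e s.2))
    (hd₂ : ∀ x y, HasDerivAt (fun s => V (x, s)) (V₂ (x, y)) y)
    (hd₁ : ∀ x y, HasDerivAt (fun s => V₂ (s, y)) (W (x, y)) x)
    {x : ℝ × ℝ} (hx : x ∈ Ioo 0 T ×ˢ Ioo 0 T) :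
    weightedMixedDeriv ψ v x = W (e x.1, e x.2) := by
  have hin : ∀ s₁ ∈ Ioo 0 T,
      deriv (fun s₂ => v (s₁, s₂)) x.2 = V₂ (e s₁, e x.2) * g x.2 := by
    intro s₁ hs₁
    have h1 : (fun s₂ => v (s₁, s₂)) =ᶠ[𝓝 x.2] fun s₂ => V (e s₁, e s₂) := by
      filter_upwards [Ioo_mem_nhds hx.2.1 hx.2.2] with s hs using hv (s₁, s) ⟨hs₁, hs⟩
    rw [h1.deriv_eq]
    exact ((hd₂ (e s₁) (e x.2)).comp x.2 (he.hasDerivAt x.2)).deriv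
  have hout : (fun s₁ => deriv (fun s₂ => v (s₁, s₂)) x.2) =ᶠ[𝓝 x.1]
      fun s₁ => V₂ (e s₁, e x.2) * g x.2 := by
    filter_upwards [Ioo_mem_nhds hx.1.1 hx.1.2] with s hs using hin s hs
  have h2 := (((hd₁ (e x.1) (e x.2)).comp x.1 (he.hasDerivAt x.1)).mul_const (g x.2)).deriv
  have h3 := he.pos x.1
  have h4 := he.pos x.2
  rw [weightedMixedDeriv, hout.deriv_eq, he.deriv_eq _ hx.1, he.deriv_eq _ hx.2]
  refine (congrArg _ h2).trans ?_
  field_simp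

/-- The `ψ`-Hilfer derivative of order `α` is, in the coordinate `e`, the Riemann–Liouville
integral of order `1 - α` of the mixed derivative. -/
lemma IsCoord.hilferDeriv_eq (he : IsCoord ψ T e g) {α β : ℝ} (hα : α ≤ 1) (hβ : 0 ≤ β ∧ β ≤ 1)
    {φ h h₂ w : ℝ × ℝ → ℝ} (hh : IsCausal h) (hh₂ : IsCausal h₂) (hw : IsCausal w)
    (hd₂ : ∀ x y, HasDerivAt (fun s => h (x, s)) (h₂ (x, y)) y)
    (hd₁ : ∀ x y, HasDerivAt (fun s => h₂ (s, y)) (w (x, y)) x)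
    (hφ : ∀ s ∈ Ioo 0 T ×ˢ Ioo 0 T, φ s = h (e s.1, e s.2))
    {x : ℝ × ℝ} (hx : x ∈ Ioo 0 T ×ˢ Ioo 0 T) :
    hilferDeriv ψ α β φ x = rlConv (1 - α) w (e x.1, e x.2) := by
  have hb : 0 ≤ (1 - β) * (1 - α) := mul_nonneg (by linarith) (by linarith)
  have ha : 0 ≤ β * (1 - α) := mul_nonneg hβ.1 (by linarith)
  have hD₂ : ∀ x y, HasDerivAt (fun s => rlConv ((1 - β) * (1 - α)) h (x, s))
      (rlConv ((1 - β) * (1 - α)) h₂ (x, y)) y := fun x y => by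
    simpa using hh.hasDerivAt_rlConv hh₂ hb (x, 0) (0, 1)
      (fun ⟨z₁, z₂⟩ s => by simpa using (hd₂ z₁ (z₂ + s)).comp_const_add z₂ s) y
  have hD₁ : ∀ x y, HasDerivAt (fun s => rlConv ((1 - β) * (1 - α)) h₂ (s, y))
      (rlConv ((1 - β) * (1 - α)) w (x, y)) x := fun x y => by
    simpa using hh₂.hasDerivAt_rlConv hw hb (0, y) (1, 0)
      (fun ⟨z₁, z₂⟩ s => by simpa using (hd₁ (z₁ + s) z₂).comp_const_add z₁ s) x
  have hmix : ∀ s ∈ Ioo 0 T ×ˢ Ioo 0 T,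
      weightedMixedDeriv ψ (fracIntegral ψ ((1 - β) * (1 - α)) φ) s
        = rlConv ((1 - β) * (1 - α)) w (e s.1, e s.2) := fun s hs =>
    he.weightedMixedDeriv_eq
      (fun z hz => he.fracIntegral_eq hb hφ hh.eq_zero hz (hh.integrable hb _)) hD₂ hD₁ hs
  -- The orders `β (1 - α)` and `(1 - β) (1 - α)` add up to `1 - α`, so the type `β` drops out.
  rw [hilferDeriv, he.fracIntegral_eq ha hmix (fun y hy => hw.rlConv_eq_zero hy) hx
    (hw.integrable_rlConv ha hb _), hw.rlConv_rlConv ha hb]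
  congr 1
  ring

/-- The coordinate map is increasing and fixes `0`, so it carries the compact support into the open
quadrant. The factor `c` accommodates the Jacobian terms of the transported derivatives. -/
lemma IsCoord.isCausal_comp (he : IsCoord ψ T e g) {φ f c : ℝ × ℝ → ℝ} (hφ : IsTest T φ)
    (hf : Continuous f) (hfφ : ∀ x, x ∉ tsupport φ → f x = 0) (hc : Continuous c) :
    IsCausal fun y => f (e.symm y.1, e.symm y.2) * c y := by
  have hcont : Continuous fun y : ℝ × ℝ => f (e.symm y.1, e.symm y.2) * c y := by fun_prop
  refine ⟨hcont, ?_, fun y hy => ?_⟩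
  · have hcs : HasCompactSupport fun y : ℝ × ℝ => f (e.symm y.1, e.symm y.2) * c y := by
      refine HasCompactSupport.intro (hφ.2.1.isCompact.image (e.prodCongr e).continuous) ?_
      intro y hy
      rw [hfφ, zero_mul]
      exact fun hmem => hy ⟨_, hmem, by ext <;> simp⟩
    simpa using hcs.exists_bound_of_continuous hcont
  · rw [hfφ, zero_mul]
    intro hmem
    have hmem' := hφ.2.2 hmem
    refine hy ⟨?_, ?_⟩
    · have := he.mono hmem'.1.1
      rw [he.zero, e.apply_symm_apply] at this
      exact this.le
    · have := he.mono hmem'.2.1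
      rw [he.zero, e.apply_symm_apply] at this
      exact this.le

/-- A test function is the fractional integral of order `α` of its `ψ`-Hilfer derivative. -/
theorem IsCoord.exists_rlConv_eq (he : IsCoord ψ T e g) {α β : ℝ} (hα : 0 ≤ α ∧ α ≤ 1)
    (hβ : 0 ≤ β ∧ β ≤ 1) {φ : ℝ × ℝ → ℝ} (hφ : IsTest T φ) :
    ∃ W : ℝ × ℝ → ℝ, Measurable W ∧ (∀ y, ¬ 0 ≤ y → W y = 0) ∧
      (∀ x ∈ Ioo 0 T ×ˢ Ioo 0 T, hilferDeriv ψ α β φ x = W (e x.1, e x.2)) ∧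
      ∀ x, φ x = rlConv α W (e x.1, e x.2) := by
  have hsmooth := hφ.1
  set φ₂ : ℝ × ℝ → ℝ := fun x => fderiv ℝ φ x (0, 1) with hφ₂
  have hφ₂s : ContDiff ℝ (⊤ : ℕ∞) φ₂ :=
    (hsmooth.fderiv_right (m := (⊤ : ℕ∞)) (by simp)).clm_apply contDiff_const
  set φ₁₂ : ℝ × ℝ → ℝ := fun x => fderiv ℝ φ₂ x (1, 0) with hφ₁₂
  have hφ₁₂s : ContDiff ℝ (⊤ : ℕ∞) φ₁₂ :=
    (hφ₂s.fderiv_right (m := (⊤ : ℕ∞)) (by simp)).clm_apply contDiff_const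
  have hz : ∀ x, x ∉ tsupport φ → φ x = 0 := fun x hx => image_eq_zero_of_notMem_tsupport hx
  have hz₂ : ∀ x, x ∉ tsupport φ → φ₂ x = 0 := fun x hx => by
    have : fderiv ℝ φ x = 0 := by
      by_contra h
      exact hx (support_fderiv_subset ℝ h)
    simp [hφ₂, this]
  have hsub : tsupport φ₂ ⊆ tsupport φ :=
    closure_minimal (fun x hx => by
      by_contra h
      exact hx (hz₂ x h)) (isClosed_tsupport φ)
  have hz₁₂ : ∀ x, x ∉ tsupport φ → φ₁₂ x = 0 := fun x hx => by
    have : fderiv ℝ φ₂ x = 0 := by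
      by_contra h
      exact hx (hsub (support_fderiv_subset ℝ h))
    simp [hφ₁₂, this]
  have hinv : Continuous fun y => (g (e.symm y))⁻¹ :=
    (he.continuous.comp e.symm.continuous).inv₀ fun y => (he.pos _).ne'
  have hcausal : IsCausal fun y => φ (e.symm y.1, e.symm y.2) * 1 :=
    he.isCausal_comp hφ hsmooth.continuous hz continuous_const
  have hcausal₂ : IsCausal fun y => φ₂ (e.symm y.1, e.symm y.2) * (g (e.symm y.2))⁻¹ :=
    he.isCausal_comp hφ hφ₂s.continuous hz₂ (hinv.comp continuous_snd)
  have hcausal₁₂ : IsCausal fun y => φ₁₂ (e.symm y.1, e.symm y.2) *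
      ((g (e.symm y.1))⁻¹ * (g (e.symm y.2))⁻¹) :=
    he.isCausal_comp hφ hφ₁₂s.continuous hz₁₂
      ((hinv.comp continuous_fst).mul (hinv.comp continuous_snd))
  have hd₂ : ∀ x y, HasDerivAt (fun s => φ (e.symm x, e.symm s) * 1)
      (φ₂ (e.symm x, e.symm y) * (g (e.symm y))⁻¹) y := fun x y => by
    have h1 : HasDerivAt (fun s => φ (e.symm x, s)) (φ₂ (e.symm x, e.symm y)) (e.symm y) :=
      (hsmooth.differentiable (by simp) _).hasFDerivAt.comp_hasDerivAt _
        ((hasDerivAt_const _ _).prodMk (hasDerivAt_id _))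
    simpa [Function.comp_def] using h1.comp y (he.hasDerivAt_symm y)
  have hd₁ : ∀ x y, HasDerivAt (fun s => φ₂ (e.symm s, e.symm y) * (g (e.symm y))⁻¹)
      (φ₁₂ (e.symm x, e.symm y) * ((g (e.symm x))⁻¹ * (g (e.symm y))⁻¹)) x := fun x y => by
    have h1 : HasDerivAt (fun s => φ₂ (s, e.symm y)) (φ₁₂ (e.symm x, e.symm y)) (e.symm x) :=
      (hφ₂s.differentiable (by simp) _).hasFDerivAt.comp_hasDerivAt _
        ((hasDerivAt_id _).prodMk (hasDerivAt_const _ _))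
    rw [← mul_assoc]
    exact (h1.comp x (he.hasDerivAt_symm x)).mul_const _
  refine ⟨rlConv (1 - α) _, hcausal₁₂.measurable_rlConv, fun y hy => hcausal₁₂.rlConv_eq_zero hy,
    fun x hx => he.hilferDeriv_eq hα.2 hβ hcausal hcausal₂ hcausal₁₂ hd₂ hd₁ (by simp) hx,
    fun x => ?_⟩
  -- The orders `α` and `1 - α` add up to one, and the order-one integral inverts the mixed
  -- derivative.
  rw [hcausal₁₂.rlConv_rlConv hα.1 (by linarith [hα.2]), add_sub_cancel,
    rlConv_one_of_hasDerivAt hcausal hcausal₂ hcausal₁₂ hd₂ hd₁]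
  simp

end Coordinates

/-! ### Poincaré inequality for test functions -/

section Poincare

variable {ψ : ℝ → ℝ} {T : ℝ} {e : ℝ ≃ₜ ℝ} {g : ℝ → ℝ}

lemma IsCoord.image_Ico (he : IsCoord ψ T e g) (x : ℝ) : e '' Ico 0 x = Ico 0 (e x) := by
  ext z
  constructor
  · rintro ⟨s, hs, rfl⟩
    exact ⟨by simpa [he.zero] using he.mono.monotone hs.1, he.mono hs.2⟩
  · intro hz
    refine ⟨e.symm z, ⟨?_, ?_⟩, e.apply_symm_apply z⟩
    · rw [← he.mono.le_iff_le, he.zero, e.apply_symm_apply]; exact hz.1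
    · rw [← he.mono.lt_iff_lt, e.apply_symm_apply]; exact hz.2

lemma IsCoord.setLIntegral_le (he : IsCoord ψ T e g) {G : ℝ} (hG : ∀ x, g x ≤ G)
    (F : ℝ → ℝ≥0∞) :
    ∫⁻ z in Ico 0 (e T), F z ≤ ENNReal.ofReal G * ∫⁻ x in Ico 0 T, F (e x) := by
  rw [← he.image_Ico, lintegral_image_eq_lintegral_abs_deriv_mul measurableSet_Ico
    (fun s _ => (he.hasDerivAt s).hasDerivWithinAt) he.mono.injective.injOn,
    ← lintegral_const_mul' _ _ ENNReal.ofReal_ne_top]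
  refine lintegral_mono fun x => ?_
  gcongr
  rw [abs_of_pos (he.pos x)]
  exact hG x

lemma IsCoord.setLIntegral_prod_le (he : IsCoord ψ T e g) {G : ℝ} (hG : ∀ x, g x ≤ G)
    {F : ℝ × ℝ → ℝ≥0∞} (hF : Measurable F) :
    ∫⁻ z in Ico 0 (e T) ×ˢ Ico 0 (e T), F z ≤ ENNReal.ofReal G * (ENNReal.ofReal G *
      ∫⁻ x in Ico 0 T ×ˢ Ico 0 T, F (e x.1, e x.2)) := by
  have heE : Measurable fun x : ℝ × ℝ => F (e x.1, e x.2) := hF.comp (by fun_prop)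
  rw [Measure.volume_eq_prod, ← Measure.prod_restrict, ← Measure.prod_restrict,
    lintegral_prod _ hF.aemeasurable, lintegral_prod _ heE.aemeasurable]
  refine (he.setLIntegral_le hG _).trans ?_
  gcongr
  rw [← lintegral_const_mul' _ _ ENNReal.ofReal_ne_top]
  exact lintegral_mono fun x => he.setLIntegral_le hG fun z => F (e x, z)

lemma rlMeasure₂_of_pos {σ : ℝ} (hσ : 0 < σ) :
    rlMeasure₂ σ = volume.withDensity fun t => rlDensity σ t.1 * rlDensity σ t.2 := by
  rw [rlMeasure₂, rlMeasure_of_pos hσ, prod_withDensity (measurable_rlDensity σ)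
    (measurable_rlDensity σ), Measure.volume_eq_prod]

/-- For `α > 1/p` the Riemann–Liouville integral of order `α` is bounded from `L^p` of the square
to `L^∞`. -/
theorem IsCoord.exists_enorm_rlConv_le (he : IsCoord ψ T e g) {α p : ℝ} (hp : 1 < p)
    (hα : 1 / p < α) :
    ∃ C : ℝ≥0∞, C ≠ ∞ ∧ ∀ W : ℝ × ℝ → ℝ, Measurable W → (∀ y, ¬ 0 ≤ y → W y = 0) →
      ∀ x ∈ Ioo 0 T ×ˢ Ioo 0 T, ‖rlConv α W (e x.1, e x.2)‖ₑ
        ≤ C * (∫⁻ x in Ico 0 T ×ˢ Ico 0 T, ‖W (e x.1, e x.2)‖ₑ ^ p) ^ (1 / p) := by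
  have hp0 : 0 < p := one_pos.trans hp
  have hα0 : 0 < α := (one_div_pos.mpr hp0).trans hα
  obtain ⟨G, hG⟩ := he.bdd
  have hpq : (Real.conjExponent p).HolderConjugate p := (Real.HolderConjugate.conjExponent hp).symm
  set p' := Real.conjExponent p with hp'
  have hp'0 : 0 < p' := hpq.pos
  -- This is `α > 1/p` rewritten through `1/p' = 1 - 1/p`.
  have hexp : -1 < (α - 1) * p' := by
    have h1 : 1 / p' = 1 - 1 / p := by
      have := hpq.inv_add_inv_eq_one
      rw [one_div, one_div]; linarith
    have h2 : (α - 1) > -(1 / p') := by rw [h1]; linarith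
    have h3 := mul_lt_mul_of_pos_right h2 hp'0
    rwa [neg_mul, one_div_mul_cancel hp'0.ne'] at h3
  set L := e T with hL
  set I := ∫⁻ t in Iic L, rlDensity α t ^ p' with hI
  have hIfin : I < ∞ := lintegral_rlDensity_rpow_lt_top L hα0 hp'0 hexp
  refine ⟨(I * I) ^ (1 / p') * (ENNReal.ofReal G * ENNReal.ofReal G) ^ (1 / p), ?_, ?_⟩
  · refine ENNReal.mul_ne_top (ENNReal.rpow_ne_top_of_nonneg (by positivity) ?_)
      (ENNReal.rpow_ne_top_of_nonneg (by positivity) ?_)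
    · exact (ENNReal.mul_lt_top hIfin hIfin).ne
    · exact ENNReal.mul_ne_top ENNReal.ofReal_ne_top ENNReal.ofReal_ne_top
  intro W hW hW0 x hx
  set y : ℝ × ℝ := (e x.1, e x.2) with hy
  -- Only `0 < t` with `t ≤ y` contributes, and `y < L` in both components. Hence kernel and
  -- function can be truncated at `L`, making the Hölder constant independent of `x`.
  set k : ℝ → ℝ≥0∞ := (Iic L).indicator (rlDensity α) with hk
  have hkm : Measurable k := (measurable_rlDensity α).indicator measurableSet_Iic
  set S : Set (ℝ × ℝ) := Ico 0 L ×ˢ Ico 0 L with hS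
  have hSm : MeasurableSet S := measurableSet_Ico.prod measurableSet_Ico
  set W₁ : ℝ × ℝ → ℝ≥0∞ := S.indicator fun z => ‖W z‖ₑ with hW₁
  have hW₁m : Measurable W₁ := hW.enorm.indicator hSm
  have hpt : ∀ t : ℝ × ℝ, rlDensity α t.1 * rlDensity α t.2 * ‖W (y - t)‖ₑ
      ≤ k t.1 * k t.2 * W₁ (y - t) := by
    intro t
    by_cases h0 : rlDensity α t.1 * rlDensity α t.2 * ‖W (y - t)‖ₑ = 0
    · rw [h0]; exact zero_le
    have hpos : ∀ s, rlDensity α s ≠ 0 → 0 < s := fun s hs => by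
      by_contra hn
      exact hs (by simp [rlDensity, hn])
    have h1 : 0 < t.1 := hpos _ fun h => h0 (by simp [h])
    have h2 : 0 < t.2 := hpos _ fun h => h0 (by simp [h])
    have h3 : 0 ≤ y - t := by
      by_contra hn
      exact h0 (by simp [hW0 _ hn])
    have h31 : 0 ≤ y.1 - t.1 := h3.1
    have h32 : 0 ≤ y.2 - t.2 := h3.2
    have h41 : y.1 < L := he.mono hx.1.2
    have h42 : y.2 < L := he.mono hx.2.2
    have hmem : y - t ∈ S :=
      ⟨⟨h31, show y.1 - t.1 < L by linarith⟩, ⟨h32, show y.2 - t.2 < L by linarith⟩⟩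
    rw [hW₁, indicator_of_mem hmem, hk, indicator_of_mem (show t.1 ∈ Iic L from mem_Iic.mpr (by linarith)),
      indicator_of_mem (show t.2 ∈ Iic L from mem_Iic.mpr (by linarith))]
  have hkI : ∫⁻ t : ℝ × ℝ, (k t.1 * k t.2) ^ p' = I * I := by
    have hki : ∫⁻ t, k t ^ p' = I := by
      rw [hI, ← lintegral_indicator measurableSet_Iic]
      refine lintegral_congr fun t => ?_
      by_cases ht : t ∈ Iic L
      · rw [hk, indicator_of_mem ht, indicator_of_mem ht]
      · rw [hk, indicator_of_notMem ht, indicator_of_notMem ht, ENNReal.zero_rpow_of_pos hp'0]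
    simp_rw [ENNReal.mul_rpow_of_nonneg _ _ hp'0.le]
    rw [Measure.volume_eq_prod, lintegral_prod_mul (hkm.pow_const _).aemeasurable
      (hkm.pow_const _).aemeasurable, hki]
  have hWI : ∫⁻ t : ℝ × ℝ, W₁ (y - t) ^ p = ∫⁻ z in S, ‖W z‖ₑ ^ p := by
    rw [lintegral_sub_left_eq_self (fun z => W₁ z ^ p) y, ← lintegral_indicator hSm]
    refine lintegral_congr fun t => ?_
    by_cases ht : t ∈ S
    · rw [hW₁, indicator_of_mem ht, indicator_of_mem ht]
    · rw [hW₁, indicator_of_notMem ht, indicator_of_notMem ht, ENNReal.zero_rpow_of_pos hp0]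
  have hkm₂ : Measurable fun t : ℝ × ℝ => rlDensity α t.1 * rlDensity α t.2 :=
    ((measurable_rlDensity α).comp measurable_fst).mul
      ((measurable_rlDensity α).comp measurable_snd)
  calc ‖rlConv α W y‖ₑ
      ≤ ∫⁻ t, ‖W (y - t)‖ₑ ∂(rlMeasure₂ α) := enorm_integral_le_lintegral_enorm _
    _ = ∫⁻ t : ℝ × ℝ, rlDensity α t.1 * rlDensity α t.2 * ‖W (y - t)‖ₑ := by
        rw [rlMeasure₂_of_pos hα0, lintegral_withDensity_eq_lintegral_mul _ hkm₂ (by fun_prop)]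
        rfl
    _ ≤ ∫⁻ t : ℝ × ℝ, k t.1 * k t.2 * W₁ (y - t) := lintegral_mono hpt
    _ ≤ (∫⁻ t : ℝ × ℝ, (k t.1 * k t.2) ^ p') ^ (1 / p') *
          (∫⁻ t : ℝ × ℝ, W₁ (y - t) ^ p) ^ (1 / p) :=
        ENNReal.lintegral_mul_le_Lp_mul_Lq _ hpq (by fun_prop) (by fun_prop)
    _ ≤ (I * I) ^ (1 / p') * (ENNReal.ofReal G * (ENNReal.ofReal G *
          ∫⁻ x in Ico 0 T ×ˢ Ico 0 T, ‖W (e x.1, e x.2)‖ₑ ^ p)) ^ (1 / p) := by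
        rw [hkI, hWI]
        gcongr
        exact he.setLIntegral_prod_le hG (F := fun z => ‖W z‖ₑ ^ p) (by fun_prop)
    _ = _ := by
        rw [← mul_assoc (ENNReal.ofReal G), ENNReal.mul_rpow_of_nonneg (_ * _) _ (by positivity),
          mul_assoc]

lemma ae_squareMeasure_mem_Ioo (T : ℝ) :
    ∀ᵐ x ∂(squareMeasure T), x ∈ Ioo 0 T ×ˢ Ioo 0 T := by
  rw [squareMeasure, square, Measure.volume_eq_prod, ← Measure.restrict_congr_set
    (Measure.set_prod_ae_eq (Ioo_ae_eq_Icc (a := 0) (b := T)) (Ioo_ae_eq_Icc (a := 0) (b := T)))]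
  exact ae_restrict_mem (measurableSet_Ioo.prod measurableSet_Ioo)

/-- Poincaré inequality: a test function is bounded by the `L^p` norm of its `ψ`-Hilfer
derivative. -/
theorem IsCoord.exists_enorm_le_eLpNorm_hilferDeriv (he : IsCoord ψ T e g) {α β p : ℝ}
    (hp : 1 < p) (hα : 1 / p < α) (hα1 : α ≤ 1) (hβ : 0 ≤ β ∧ β ≤ 1) :
    ∃ C : ℝ≥0∞, C ≠ ∞ ∧ ∀ φ : ℝ × ℝ → ℝ, IsTest T φ → ∀ x,
      ‖φ x‖ₑ ≤ C * eLpNorm (hilferDeriv ψ α β φ) (ENNReal.ofReal p) (squareMeasure T) := by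
  have hp0 : 0 < p := one_pos.trans hp
  have hα0 : 0 < α := (one_div_pos.mpr hp0).trans hα
  obtain ⟨C, hC, hbound⟩ := he.exists_enorm_rlConv_le hp hα
  refine ⟨C, hC, fun φ hφ x => ?_⟩
  by_cases hx : x ∈ Ioo 0 T ×ˢ Ioo 0 T
  swap
  · rw [image_eq_zero_of_notMem_tsupport fun h => hx (hφ.2.2 h)]
    simp
  obtain ⟨W, hWm, hW0, hWD, hWφ⟩ := he.exists_rlConv_eq ⟨hα0.le, hα1⟩ hβ hφ
  rw [hWφ x]
  refine (hbound W hWm hW0 x hx).trans_eq ?_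
  have hae : hilferDeriv ψ α β φ =ᵐ[squareMeasure T] fun x => W (e x.1, e x.2) := by
    filter_upwards [ae_squareMeasure_mem_Ioo T] with x hx using hWD x hx
  rw [eLpNorm_congr_ae hae, eLpNorm_eq_lintegral_rpow_enorm_toReal (by simpa using hp0)
    ENNReal.ofReal_ne_top, ENNReal.toReal_ofReal hp0.le, squareMeasure, square,
    Measure.volume_eq_prod, Measure.restrict_congr_set
    (Measure.set_prod_ae_eq (Ico_ae_eq_Icc (a := 0) (b := T)) (Ico_ae_eq_Icc (a := 0) (b := T)))]

end Poincare

/-! ### Modular, Luxemburg norm, and passage to the completion -/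

section LuxemburgNorm

instance (T : ℝ) : IsFiniteMeasure (squareMeasure T) := by
  refine ⟨?_⟩
  rw [squareMeasure, Measure.restrict_apply_univ]
  exact (isCompact_Icc.prod isCompact_Icc).measure_lt_top

variable {T α β p q : ℝ} {ψ : ℝ → ℝ} {μ f u v : ℝ × ℝ → ℝ}

lemma lintegral_rpow_le_modular (hμ0 : ∀ᵐ x ∂(squareMeasure T), 0 ≤ μ x) :
    ∫⁻ x, ENNReal.ofReal (|f x| ^ p) ∂(squareMeasure T) ≤ modular T p q μ f := by
  refine lintegral_mono_ae ?_
  filter_upwards [hμ0] with x hx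
  gcongr
  have := mul_nonneg hx (Real.rpow_nonneg (abs_nonneg (f x)) q)
  linarith

lemma eLpNorm_eq_lintegral_ofReal (hp : 0 < p) :
    eLpNorm f (ENNReal.ofReal p) (squareMeasure T)
      = (∫⁻ x, ENNReal.ofReal (|f x| ^ p) ∂(squareMeasure T)) ^ (1 / p) := by
  rw [eLpNorm_eq_lintegral_rpow_enorm_toReal (by simpa using hp) ENNReal.ofReal_ne_top,
    ENNReal.toReal_ofReal hp.le]
  congr 1
  refine lintegral_congr fun x => ?_
  rw [Real.enorm_eq_ofReal_abs, ENNReal.ofReal_rpow_of_nonneg (abs_nonneg _) hp.le]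

lemma eLpNorm_le_of_modular_div_le_one (hp : 0 < p)
    (hμ0 : ∀ᵐ x ∂(squareMeasure T), 0 ≤ μ x) {τ : ℝ} (hτ : 0 < τ)
    (h : modular T p q μ (fun x => f x / τ) ≤ 1) :
    eLpNorm f (ENNReal.ofReal p) (squareMeasure T) ≤ ENNReal.ofReal τ := by
  have h1 : eLpNorm (fun x => f x / τ) (ENNReal.ofReal p) (squareMeasure T) ≤ 1 := by
    rw [eLpNorm_eq_lintegral_ofReal hp]
    exact ENNReal.rpow_le_one ((lintegral_rpow_le_modular hμ0).trans h) (by positivity)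
  have h2 : f = τ • fun x => f x / τ := by
    ext x
    simp only [Pi.smul_apply, smul_eq_mul]
    field_simp
  rw [h2, eLpNorm_const_smul, Real.enorm_eq_ofReal hτ.le]
  exact mul_le_of_le_one_right' h1

/-- Both exponents are at least one, so `τ ^ s ≥ τ` for `τ ≥ 1`. -/
lemma modular_div_le (hp : 1 ≤ p) (hq : 1 ≤ q) (hμ0 : ∀ᵐ x ∂(squareMeasure T), 0 ≤ μ x)
    {τ : ℝ} (hτ : 1 ≤ τ) :
    modular T p q μ (fun x => f x / τ) ≤ ENNReal.ofReal τ⁻¹ * modular T p q μ f := by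
  rw [modular, modular, ← lintegral_const_mul' _ _ ENNReal.ofReal_ne_top]
  refine lintegral_mono_ae ?_
  filter_upwards [hμ0] with x hx
  have hτ0 : 0 < τ := one_pos.trans_le hτ
  rw [← ENNReal.ofReal_mul (by positivity)]
  gcongr
  have key : ∀ s : ℝ, 1 ≤ s → |f x / τ| ^ s ≤ τ⁻¹ * |f x| ^ s := fun s hs => by
    rw [abs_div, abs_of_pos hτ0, Real.div_rpow (abs_nonneg _) hτ0.le, div_eq_inv_mul]
    gcongr
    exact Real.self_le_rpow_of_one_le hτ hs
  rw [mul_add, mul_left_comm]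
  exact add_le_add (key p hp) (mul_le_mul_of_nonneg_left (key q hq) hx)

lemma luxNorm_le {τ : ℝ} (hτ : 0 < τ) (h : modular T p q μ (fun x => f x / τ) ≤ 1) :
    luxNorm T p q μ f ≤ τ :=
  csInf_le ⟨0, fun _ hs => hs.1.le⟩ ⟨hτ, h⟩

lemma modular_div_one_add_le (hp : 1 ≤ p) (hq : 1 ≤ q)
    (hμ0 : ∀ᵐ x ∂(squareMeasure T), 0 ≤ μ x) (hf : MemLH T p q μ f) :
    modular T p q μ (fun x => f x / (1 + (modular T p q μ f).toReal)) ≤ 1 := by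
  set R := (modular T p q μ f).toReal with hR
  have hR0 : 0 ≤ R := ENNReal.toReal_nonneg
  refine (modular_div_le hp hq hμ0 (by linarith)).trans ?_
  rw [← ENNReal.ofReal_toReal hf.2.ne, ← hR, ← ENNReal.ofReal_mul (by positivity),
    ENNReal.ofReal_le_one, inv_mul_le_one₀ (by positivity)]
  linarith

lemma luxNorm_le_one_add (hp : 1 ≤ p) (hq : 1 ≤ q) (hμ0 : ∀ᵐ x ∂(squareMeasure T), 0 ≤ μ x)
    (hf : MemLH T p q μ f) : luxNorm T p q μ f ≤ 1 + (modular T p q μ f).toReal :=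
  luxNorm_le (by positivity) (modular_div_one_add_le hp hq hμ0 hf)

/-- Every admissible `τ` bounds the `L^p` norm. Membership in the space makes the admissible set
nonempty; for an empty set the real `sInf` would be `0` and give no bound. -/
lemma eLpNorm_le_luxNorm (hp : 1 ≤ p) (hq : 1 ≤ q) (hμ0 : ∀ᵐ x ∂(squareMeasure T), 0 ≤ μ x)
    (hf : MemLH T p q μ f) :
    eLpNorm f (ENNReal.ofReal p) (squareMeasure T) ≤ ENNReal.ofReal (luxNorm T p q μ f) := by
  have hp0 : 0 < p := one_pos.trans_le hp
  have hne : {τ : ℝ | 0 < τ ∧ modular T p q μ (fun x => f x / τ) ≤ 1}.Nonempty :=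
    ⟨_, by positivity, modular_div_one_add_le hp hq hμ0 hf⟩
  have hbd : ∀ τ ∈ {τ : ℝ | 0 < τ ∧ modular T p q μ (fun x => f x / τ) ≤ 1},
      (eLpNorm f (ENNReal.ofReal p) (squareMeasure T)).toReal ≤ τ := fun τ hτ =>
    ENNReal.toReal_le_of_le_ofReal hτ.1.le (eLpNorm_le_of_modular_div_le_one hp0 hμ0 hτ.1 hτ.2)
  obtain ⟨τ, hτ⟩ := hne
  refine ENNReal.le_ofReal_iff_toReal_le ?_ ?_ |>.mpr (le_csInf ⟨τ, hτ⟩ hbd)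
  · exact ((eLpNorm_le_of_modular_div_le_one hp0 hμ0 hτ.1 hτ.2).trans_lt
      ENNReal.ofReal_lt_top).ne
  · exact le_csInf ⟨τ, hτ⟩ fun _ h => h.1.le

lemma MemLH.sub (hp : 0 ≤ p) (hq : 0 ≤ q) (hμ : AEMeasurable μ (squareMeasure T))
    (hμ0 : ∀ᵐ x ∂(squareMeasure T), 0 ≤ μ x) (hu : MemLH T p q μ u) (hv : MemLH T p q μ v) :
    MemLH T p q μ fun x => u x - v x := by
  refine ⟨hu.1.sub hv.1, ?_⟩
  set c : ℝ := max (2 ^ p) (2 ^ q) with hc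
  have hc0 : 0 ≤ c := by positivity
  have key : ∀ s : ℝ, 0 ≤ s → ∀ x y : ℝ, |x - y| ^ s ≤ 2 ^ s * (|x| ^ s + |y| ^ s) := by
    intro s hs x y
    have h1 : |x - y| ≤ 2 * max |x| |y| := by
      have := abs_sub x y
      have h2 := le_max_left |x| |y|
      have h3 := le_max_right |x| |y|
      linarith
    have h2 : max |x| |y| ^ s ≤ |x| ^ s + |y| ^ s := by
      rcases max_choice |x| |y| with h | h <;> rw [h]
      · exact le_add_of_nonneg_right (by positivity)
      · exact le_add_of_nonneg_left (by positivity)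
    calc |x - y| ^ s ≤ (2 * max |x| |y|) ^ s := by gcongr
      _ = 2 ^ s * max |x| |y| ^ s := Real.mul_rpow (by norm_num) (by positivity)
      _ ≤ _ := by gcongr
  have hle : modular T p q μ (fun x => u x - v x)
      ≤ ENNReal.ofReal c * (modular T p q μ u + modular T p q μ v) := by
    rw [modular, modular, modular, ← lintegral_add_left', ← lintegral_const_mul' _ _
      ENNReal.ofReal_ne_top]
    · refine lintegral_mono_ae ?_
      filter_upwards [hμ0] with x hx
      rw [← ENNReal.ofReal_add (by positivity) (by positivity), ← ENNReal.ofReal_mul hc0]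
      gcongr
      have h1 : |u x - v x| ^ p ≤ c * (|u x| ^ p + |v x| ^ p) :=
        (key p hp _ _).trans (by gcongr; exact le_max_left _ _)
      have h2 : |u x - v x| ^ q ≤ c * (|u x| ^ q + |v x| ^ q) :=
        (key q hq _ _).trans (by gcongr; exact le_max_right _ _)
      have h3 := mul_le_mul_of_nonneg_left h2 hx
      linarith
    · have h1 := hu.1
      have h2 : AEMeasurable (fun x => |u x|) (squareMeasure T) :=
        continuous_abs.measurable.comp_aemeasurable h1
      exact ((h2.pow_const p).add (hμ.mul (h2.pow_const q))).ennreal_ofReal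
  exact hle.trans_lt (ENNReal.mul_lt_top ENNReal.ofReal_lt_top (ENNReal.add_lt_top.mpr ⟨hu.2, hv.2⟩))

lemma modular_le_of_bounded {N K : ℝ} (hp : 0 ≤ p) (hq : 0 ≤ q)
    (hμ0 : ∀ᵐ x ∂(squareMeasure T), 0 ≤ μ x) (hμN : ∀ᵐ x ∂(squareMeasure T), μ x ≤ N)
    (hf : ∀ᵐ x ∂(squareMeasure T), |f x| ≤ K) :
    modular T p q μ f ≤ ENNReal.ofReal (K ^ p + N * K ^ q) * squareMeasure T univ := by
  rw [← lintegral_const]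
  refine lintegral_mono_ae ?_
  filter_upwards [hμ0, hμN, hf] with x h0 hN hK
  have hK0 : 0 ≤ K := (abs_nonneg _).trans hK
  gcongr
  exact h0.trans hN

lemma exists_forall_ae_abs_le (hμ : MemLp f ∞ (squareMeasure T)) :
    ∃ N : ℝ, 0 ≤ N ∧ ∀ᵐ x ∂(squareMeasure T), |f x| ≤ N := by
  refine ⟨(eLpNorm f ∞ (squareMeasure T)).toReal, ENNReal.toReal_nonneg, ?_⟩
  have h := hμ.2
  rw [eLpNorm_exponent_top] at h ⊢
  filter_upwards [ae_le_eLpNormEssSup (f := f) (μ := squareMeasure T)] with x hx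
  have := ENNReal.toReal_mono h.ne hx
  simpa using this

lemma IsTest.memLH (hp : 0 ≤ p) (hq : 0 ≤ q) (hμ : MemLp μ ∞ (squareMeasure T))
    (hμ0 : ∀ᵐ x ∂(squareMeasure T), 0 ≤ μ x) {φ : ℝ × ℝ → ℝ} (hφ : IsTest T φ) :
    MemLH T p q μ φ := by
  obtain ⟨N, -, hN⟩ := exists_forall_ae_abs_le hμ
  obtain ⟨K, hK⟩ := hφ.2.1.exists_bound_of_continuous hφ.1.continuous
  exact ⟨hφ.1.continuous.aemeasurable, (modular_le_of_bounded hp hq hμ0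
    (hN.mono fun x hx => (le_abs_self _).trans hx) (ae_of_all _ hK)).trans_lt
    (ENNReal.mul_lt_top ENNReal.ofReal_lt_top (measure_lt_top _ _))⟩

/-- Poincaré inequality: the elements of the `ψ`-Hilfer space are bounded by the `L^p` norm of
their `ψ`-Hilfer derivative. -/
theorem exists_ae_enorm_le_eLpNorm_hderiv (hT : 0 < T) (hψ : ContDiffOn ℝ 1 ψ (Icc 0 T))
    (hψ_mono : StrictMonoOn ψ (Icc 0 T)) (hψ' : ∀ x ∈ Icc 0 T, derivWithin ψ (Icc 0 T) x ≠ 0)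
    (hα : 1 / p < α) (hα1 : α ≤ 1) (hβ : 0 ≤ β ∧ β ≤ 1) (hp : 1 < p) (hq : 1 ≤ q)
    (hμ : MemLp μ ∞ (squareMeasure T)) (hμ0 : ∀ᵐ x ∂(squareMeasure T), 0 ≤ μ x) :
    ∃ C : ℝ≥0∞, C ≠ ∞ ∧ ∀ u : HilferSpace T α β p q ψ μ, ∀ᵐ x ∂(squareMeasure T),
      ‖u.toFun x‖ₑ ≤ C * eLpNorm u.hderiv (ENNReal.ofReal p) (squareMeasure T) := by
  obtain ⟨e, g, he⟩ := exists_isCoord hT hψ hψ_mono hψ'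
  obtain ⟨C, hC, hbound⟩ := he.exists_enorm_le_eLpNorm_hilferDeriv (β := β) hp hα hα1 hβ
  refine ⟨C, hC, fun u => ?_⟩
  have hp0 : 0 ≤ p := by linarith
  have hq0 : 0 ≤ q := by linarith
  have hμm := hμ.1.aemeasurable
  obtain ⟨φ, hφ, hDφ, hlim, hDlim⟩ := u.exists_approx
  have hconv : ∀ (F : ℕ → ℝ × ℝ → ℝ) (f : ℝ × ℝ → ℝ), (∀ n, MemLH T p q μ (F n)) →
      MemLH T p q μ f →
      Tendsto (fun n => luxNorm T p q μ (fun x => F n x - f x)) atTop (𝓝 0) →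
      Tendsto (fun n => eLpNorm (F n - f) (ENNReal.ofReal p) (squareMeasure T)) atTop (𝓝 0) := by
    intro F f hF hf h
    refine tendsto_of_tendsto_of_tendsto_of_le_of_le tendsto_const_nhds
      (by simpa using ENNReal.tendsto_ofReal h) (fun _ => zero_le) fun n => ?_
    exact eLpNorm_le_luxNorm hp.le hq hμ0 ((hF n).sub hp0 hq0 hμm hμ0 hf)
  have h1 := hconv φ u.toFun (fun n => (hφ n).memLH hp0 hq0 hμ hμ0) u.memLH_toFun hlim
  have h2 := hconv _ u.hderiv hDφ u.memLH_hderiv hDlim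
  -- `L^p` convergence of the approximations gives a.e. convergence along a subsequence, and the
  -- constant `C` is the same for all of them.
  obtain ⟨ns, hns, hae⟩ := (tendstoInMeasure_of_tendsto_eLpNorm
    (by simpa using (one_pos.trans hp)) (fun n => (hφ n).1.continuous.aestronglyMeasurable)
    u.memLH_toFun.1.aestronglyMeasurable h1).exists_seq_tendsto_ae
  filter_upwards [hae] with x hx
  have h3 : Tendsto (fun n => C * (eLpNorm (hilferDeriv ψ α β (φ (ns n)) - u.hderiv)
      (ENNReal.ofReal p) (squareMeasure T)
      + eLpNorm u.hderiv (ENNReal.ofReal p) (squareMeasure T))) atTop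
      (𝓝 (C * (0 + eLpNorm u.hderiv (ENNReal.ofReal p) (squareMeasure T)))) :=
    ENNReal.Tendsto.const_mul ((h2.comp hns.tendsto_atTop).add_const _) (Or.inr hC)
  rw [zero_add] at h3
  refine le_of_tendsto_of_tendsto ((continuous_enorm.tendsto _).comp hx) h3
    (Eventually.of_forall fun n => (hbound _ (hφ _) x).trans (mul_le_mul_right ?_ C))
  have h4 := eLpNorm_add_le (μ := squareMeasure T) (p := ENNReal.ofReal p)
    ((hDφ (ns n)).1.sub u.memLH_hderiv.1).aestronglyMeasurable
    u.memLH_hderiv.1.aestronglyMeasurable (by simpa using hp.le)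
  rwa [sub_add_cancel] at h4

end LuxemburgNorm

/-! ### Bounds in terms of the modular of the derivative -/

section Bounds

variable {T α β p q : ℝ} {ψ : ℝ → ℝ} {μ f : ℝ × ℝ → ℝ}

lemma MemLH.toReal_modular (hμ : AEMeasurable μ (squareMeasure T))
    (hμ0 : ∀ᵐ x ∂(squareMeasure T), 0 ≤ μ x) (hf : MemLH T p q μ f) :
    (modular T p q μ f).toReal = (∫ x, |f x| ^ p ∂(squareMeasure T))
      + ∫ x, μ x * |f x| ^ q ∂(squareMeasure T) := by
  have habs : AEMeasurable (fun x => |f x|) (squareMeasure T) :=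
    continuous_abs.measurable.comp_aemeasurable hf.1
  have h₁m : AEMeasurable (fun x => |f x| ^ p) (squareMeasure T) := habs.pow_const p
  have h₂m : AEMeasurable (fun x => μ x * |f x| ^ q) (squareMeasure T) :=
    hμ.mul (habs.pow_const q)
  have h₁0 : ∀ x, 0 ≤ |f x| ^ p := fun x => by positivity
  have h₂0 : ∀ᵐ x ∂(squareMeasure T), 0 ≤ μ x * |f x| ^ q := by
    filter_upwards [hμ0] with x hx using by positivity
  have hsum : modular T p q μ f = ∫⁻ x, ENNReal.ofReal (|f x| ^ p) ∂(squareMeasure T)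
      + ∫⁻ x, ENNReal.ofReal (μ x * |f x| ^ q) ∂(squareMeasure T) := by
    rw [modular, ← lintegral_add_left' h₁m.ennreal_ofReal]
    refine lintegral_congr_ae ?_
    filter_upwards [h₂0] with x hx using ENNReal.ofReal_add (h₁0 x) hx
  have hfin := hf.2
  rw [hsum, ENNReal.add_lt_top] at hfin
  rw [hsum, ENNReal.toReal_add hfin.1.ne hfin.2.ne,
    integral_eq_lintegral_of_nonneg_ae (ae_of_all _ h₁0) h₁m.aestronglyMeasurable,
    integral_eq_lintegral_of_nonneg_ae h₂0 h₂m.aestronglyMeasurable]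

/-- Factor the right side as `(c X^γ - K) X^(1-γ)`; both factors tend to infinity. -/
lemma eventually_le_mul_sub_mul_rpow {c K γ : ℝ} (hc : 0 < c) (hγ : 0 < γ ∧ γ < 1) (M : ℝ) :
    ∀ᶠ X : ℝ in atTop, M ≤ c * X - K * X ^ (1 - γ) := by
  have h : Tendsto (fun X : ℝ => (c * X ^ γ - K) * X ^ (1 - γ)) atTop atTop :=
    (tendsto_atTop_add_const_right _ (-K)
      ((tendsto_rpow_atTop hγ.1).const_mul_atTop hc)).atTop_mul_atTop₀
      (tendsto_rpow_atTop (by linarith [hγ.2]))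
  filter_upwards [h.eventually_ge_atTop M, eventually_gt_atTop 0] with X hX hX0
  rw [sub_mul, mul_assoc, ← Real.rpow_add hX0, add_sub_cancel, Real.rpow_one] at hX
  exact hX

/-- In terms of `X = 1 + ρ(D u)`, the elements of the `ψ`-Hilfer space are bounded by a multiple
of `X`, and so is the norm. -/
theorem exists_bounds (hT : 0 < T) (hψ : ContDiffOn ℝ 1 ψ (Icc 0 T))
    (hψ_mono : StrictMonoOn ψ (Icc 0 T)) (hψ' : ∀ x ∈ Icc 0 T, derivWithin ψ (Icc 0 T) x ≠ 0)
    (hα : 1 / p < α) (hα1 : α ≤ 1) (hβ : 0 ≤ β ∧ β ≤ 1) (hp : 1 < p) (hq : 1 ≤ q)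
    (hμ : MemLp μ ∞ (squareMeasure T)) (hμ0 : ∀ᵐ x ∂(squareMeasure T), 0 ≤ μ x) :
    ∃ C K : ℝ, 0 ≤ C ∧ 0 < K ∧ ∀ u : HilferSpace T α β p q ψ μ,
      (∀ᵐ x ∂(squareMeasure T),
        |u.toFun x| ≤ C * (1 + (modular T p q μ u.hderiv).toReal)) ∧
      u.sobolevNorm ≤ K * (1 + (modular T p q μ u.hderiv).toReal) := by
  obtain ⟨C, hC, hbound⟩ := exists_ae_enorm_le_eLpNorm_hderiv (μ := μ) hT hψ hψ_mono hψ' hα hα1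
    hβ hp hq hμ hμ0
  obtain ⟨N, hN0, hN⟩ := exists_forall_ae_abs_le hμ
  have hN' := hN.mono fun x hx => (le_abs_self _).trans hx
  -- `Q` bounds the modular of `u / X`, since `|u / X| ≤ C`. A further division by `1 + Q` brings
  -- the modular below one, so `u` has norm at most `(1 + Q) X`; the derivative contributes at most
  -- `X`.
  set Q : ℝ≥0∞ := ENNReal.ofReal (C.toReal ^ p + N * C.toReal ^ q) * squareMeasure T univ with hQ
  have hQfin : Q ≠ ∞ := (ENNReal.mul_lt_top ENNReal.ofReal_lt_top (measure_lt_top _ _)).ne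
  have hQ0 : 0 ≤ Q.toReal := ENNReal.toReal_nonneg
  refine ⟨C.toReal, 1 + (1 + Q.toReal), ENNReal.toReal_nonneg, by positivity, fun u => ?_⟩
  set X := 1 + (modular T p q μ u.hderiv).toReal with hX
  have hX0 : 0 < X := by positivity
  have hL : eLpNorm u.hderiv (ENNReal.ofReal p) (squareMeasure T) ≤ ENNReal.ofReal X :=
    eLpNorm_le_of_modular_div_le_one (one_pos.trans hp) hμ0 hX0
      (modular_div_one_add_le hp.le hq hμ0 u.memLH_hderiv)
  have hu : ∀ᵐ x ∂(squareMeasure T), |u.toFun x| ≤ C.toReal * X := by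
    filter_upwards [hbound u] with x hx
    have h1 : ‖u.toFun x‖ₑ ≤ ENNReal.ofReal (C.toReal * X) := by
      rw [ENNReal.ofReal_mul ENNReal.toReal_nonneg, ENNReal.ofReal_toReal hC]
      exact hx.trans (by gcongr)
    rw [Real.enorm_eq_ofReal_abs] at h1
    exact (ENNReal.ofReal_le_ofReal_iff (by positivity)).mp h1
  refine ⟨hu, ?_⟩
  have hmod : modular T p q μ (fun x => u.toFun x / X) ≤ Q := by
    refine modular_le_of_bounded (by linarith) (by linarith) hμ0 hN' ?_
    filter_upwards [hu] with x hx
    rw [abs_div, abs_of_pos hX0, div_le_iff₀ hX0]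
    exact hx
  have hlux : luxNorm T p q μ u.toFun ≤ X * (1 + Q.toReal) := by
    refine luxNorm_le (by positivity) ?_
    simp_rw [← div_div]
    refine (modular_div_le hp.le hq hμ0 (by linarith)).trans ?_
    calc ENNReal.ofReal (1 + Q.toReal)⁻¹ * modular T p q μ (fun x => u.toFun x / X)
        ≤ ENNReal.ofReal (1 + Q.toReal)⁻¹ * ENNReal.ofReal Q.toReal := by
          rw [ENNReal.ofReal_toReal hQfin]; gcongr
      _ ≤ 1 := by
          rw [← ENNReal.ofReal_mul (by positivity), ENNReal.ofReal_le_one,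
            inv_mul_le_one₀ (by positivity)]
          linarith
  have h1 := luxNorm_le_one_add hp.le hq hμ0 u.memLH_hderiv
  rw [HilferSpace.sobolevNorm]
  linarith

end Bounds

end DoublePhase

/-! ### Coercivity on the Nehari set -/

theorem proposition3p1
    (T α β p q r γ l : ℝ) (ψ : ℝ → ℝ) (μ a : ℝ × ℝ → ℝ)
    (hT : 0 < T)
    (hψ : ContDiffOn ℝ 1 ψ (Icc 0 T)) (hψ_mono : StrictMonoOn ψ (Icc 0 T))
    (hψ' : ∀ x ∈ Icc 0 T, derivWithin ψ (Icc 0 T) x ≠ 0)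
    (hα : 1 / p < α ∧ α < 1) (hβ : 0 ≤ β ∧ β ≤ 1)
    (hp : 1 < p ∧ p < 2) (hq : p < q ∧ q < 2 * p / (2 - α * p))
    (hμ : MemLp μ ∞ (squareMeasure T)) (hμ_nonneg : ∀ᵐ x ∂(squareMeasure T), 0 ≤ μ x)
    (hγ : 0 < γ ∧ γ < 1) (hr : q < r ∧ r < 2 * p / (2 - α * p))
    (ha : MemLp a ∞ (squareMeasure T)) (ha_pos : ∀ᵐ x ∂(squareMeasure T), 0 < a x) :
    CoerciveOn (energy a γ l r)
      (nehari a γ l r : Set (HilferSpace T α β p q ψ μ)) := by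
  intro M
  have hp1 := hp.1
  have hpq := hq.1
  have hqr := hr.1
  obtain ⟨C, K, hC, hK, hbounds⟩ := exists_bounds (μ := μ) hT hψ hψ_mono hψ' hα.1 hα.2.le hβ hp.1
    (by linarith : 1 ≤ q) hμ hμ_nonneg
  obtain ⟨N, hN0, hN⟩ := exists_forall_ae_abs_le ha
  set V := (squareMeasure T).real univ with hV
  set c := 1 / q - 1 / r with hc
  have hc0 : 0 < c := sub_pos.mpr (one_div_lt_one_div_of_lt (by linarith) hqr)
  -- The target is `M + c` because `c R = c X - c` with `X = 1 + R`.
  obtain ⟨X₀, hX₀⟩ := eventually_atTop.mp (eventually_le_mul_sub_mul_rpow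
    (K := 1 / (1 - γ) * (N * C ^ (1 - γ) * V)) hc0 hγ (M + c))
  refine ⟨K * X₀, fun u hu hnorm => ?_⟩
  obtain ⟨hub, hsob⟩ := hbounds u
  have hR := u.memLH_hderiv.toReal_modular hμ.1.aemeasurable hμ_nonneg
  set R := (modular T p q μ u.hderiv).toReal
  have hR0 : 0 ≤ R := ENNReal.toReal_nonneg
  have hXX : X₀ ≤ 1 + R := le_of_mul_le_mul_left (hnorm.trans hsob) hK
  have hgrow := hX₀ _ hXX
  have hS : ∫ x, a x * |u.toFun x| ^ (1 - γ) ∂(squareMeasure T)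
      ≤ N * C ^ (1 - γ) * V * (1 + R) ^ (1 - γ) := by
    have h1 : ∫ x, a x * |u.toFun x| ^ (1 - γ) ∂(squareMeasure T)
        ≤ ∫ _, N * (C * (1 + R)) ^ (1 - γ) ∂(squareMeasure T) := by
      refine integral_mono_of_nonneg ?_ (integrable_const _) ?_
      · filter_upwards [ha_pos] with x hx
        exact mul_nonneg hx.le (by positivity)
      · filter_upwards [hN, hub] with x h2 h3
        exact mul_le_mul ((le_abs_self _).trans h2)
          (Real.rpow_le_rpow (abs_nonneg _) h3 (by linarith [hγ.2])) (by positivity) hN0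
    refine h1.trans_eq ?_
    rw [integral_const, smul_eq_mul, Real.mul_rpow hC (by positivity)]
    ring
  have hA0 : 0 ≤ ∫ x, |u.hderiv x| ^ p ∂(squareMeasure T) :=
    integral_nonneg fun x => by positivity
  have hS0 : 0 ≤ ∫ x, a x * |u.toFun x| ^ (1 - γ) ∂(squareMeasure T) := by
    refine integral_nonneg_of_ae ?_
    filter_upwards [ha_pos] with x hx
    exact mul_nonneg hx.le (by positivity)
  have hneh := hu.2
  rw [energy]
  set A := ∫ x, |u.hderiv x| ^ p ∂(squareMeasure T)
  set B := ∫ x, μ x * |u.hderiv x| ^ q ∂(squareMeasure T)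
  set S := ∫ x, a x * |u.toFun x| ^ (1 - γ) ∂(squareMeasure T)
  set Z := ∫ x, |u.toFun x| ^ r ∂(squareMeasure T)
  -- The constraint replaces `l Z` by `A + B - S`. The terms `(1/p - 1/q) A` and `S / r` are
  -- nonnegative and are discarded below.
  have hE : 1 / p * A + 1 / q * B - 1 / (1 - γ) * S - l / r * Z
      = c * (A + B) + (1 / p - 1 / q) * A + 1 / r * S - 1 / (1 - γ) * S := by
    have : l / r * Z = 1 / r * (A + B - S) := by rw [hneh]; ring
    rw [this, hc]; ring
  have hpq' : 0 ≤ (1 / p - 1 / q) * A :=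
    mul_nonneg (sub_nonneg.mpr (one_div_le_one_div_of_le (by linarith) hpq.le)) hA0
  have hrS : 0 ≤ 1 / r * S := mul_nonneg (one_div_nonneg.mpr (by linarith)) hS0
  have hSγ := mul_le_mul_of_nonneg_left hS (one_div_nonneg.mpr (by linarith [hγ.2] : 0 ≤ 1 - γ))
  rw [hE, ← hR]
  linarith
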